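/- Let $\Gamma$ be a countable discrete group with Kazhdan's property (T). Probability spaces $(X,\mu)$, $(Y,\nu)$ are standard, isomorphisms between them are measure preserving and understood modulo null sets, and for isomorphisms $\varphi,\psi:(X,\mu)\simeq(Y,\nu)$ write $$\|\varphi-\psi\|_2=\bigl(2-2\mu\{x:\varphi(x)=\psi(x)\}\bigr)^{1/2}.$$ A pmp action is a probability measure preserving action by measurable maps; it is free if $\{x : gx=x\}$ is null for every $g\neq e$. Two pmp actions $\Gamma\curvearrowright^\sigma(X,\mu)$, $\Gamma\curvearrowright^\rho(Y,\nu)$ are conjugate if there are $\alpha\in\mathrm{Aut}(\Gamma)$ and an isomorphism $\theta:(X,\mu)\simeq(Y,\nu)$ with $\theta\sigma_g=\rho_{\alpha(g)}\theta$ almost everywhere for all $g\in\Gamma$; they are app-conjugate if there are $\alpha\in\mathrm{Aut}(\Gamma)$ and isomorphisms $\theta_n:(X,\mu)\simeq(Y,\nu)$, $n\in\mathbb N$, with $\lim_n\|\theta_n\sigma_g\theta_n^{-1}-\rho_{\alpha(g)}\|_2=0$ for all $g\in\Gamma$. Then: (1) Let $F\subset\Gamma$ be a finite set of generators. For every $\varepsilon>0$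 there is $\delta>0$ (depending only on $\Gamma$, $F$, $\varepsilon$) such that if $\Gamma\curvearrowright^\sigma(X,\mu)$ and $\Gamma\curvearrowright^\rho(Y,\nu)$ are free ergodic pmp actions and $\theta:(X,\mu)\simeq(Y,\nu)$ satisfies $\|\theta\sigma_g\theta^{-1}-\rho_g\|_2\le\delta$ for all $g\in F$, then there is $\theta':(X,\mu)\simeq(Y,\nu)$ with $\theta'\sigma_g=\rho_g\theta'$ almost everywhere for all $g\in\Gamma$ and $\|\theta'-\theta\|_2\le\varepsilon$. (2) Two free ergodic pmp $\Gamma$-actions are app-conjugate if and only if they are conjugate. (3) Let $\Gamma\curvearrowright^\sigma(X,\mu)$ be a pmp action. If $\theta_n\in\mathrm{Aut}(X,\mu)$, $n\in\mathbb N$, satisfy $\lim_n\|\theta_n\sigma_g-\sigma_g\theta_n\|_2=0$ for all $g\in\Gamma$, then there are $\theta_n'\in\mathrm{Aut}(X,\mu)$ such that $\theta_n'\sigma_g=\sigma_g\theta_n'$ almost everywhere for all $n$ and all $g\in\Gamma$, and $\lim_n\|\theta_n'-\theta_n\|_2=0$. -/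

import Mathlib

open MeasureTheory Filter Topology

universe u v w

/-- Kazhdan's property (T) for a discrete group `Γ`: there is a Kazhdan pair `(Q, κ)`, that is, a
finite set `Q ⊆ Γ` and `κ > 0` such that every unitary representation of `Γ` on a complex Hilbert
space which has a nonzero `(Q, κ)`-invariant vector has a nonzero `Γ`-invariant vector.
Hilbert spaces in the universe of `Γ` suffice: the closed invariant subspace generated by a single
vector has a dense subset of cardinality at most `max |Γ| ℵ₀`. -/
def HasPropertyT (Γ : Type u) [Group Γ] : Prop :=
  ∃ (Q : Finset Γ) (κ : ℝ), 0 < κ ∧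
    ∀ (H : Type u) [NormedAddCommGroup H] [InnerProductSpace ℂ H] [CompleteSpace H]
      (π : Γ →* (H ≃ₗᵢ[ℂ] H)),
      (∃ ξ : H, ξ ≠ 0 ∧ ∀ g ∈ Q, ‖π g ξ - ξ‖ < κ * ‖ξ‖) →
        ∃ η : H, η ≠ 0 ∧ ∀ g : Γ, π g η = η

/-- The action of `Γ` on `(X, μ)` is (essentially) free: every `g ≠ 1` fixes almost no point. -/
def EssentiallyFree (Γ : Type u) [Group Γ] {X : Type v} [MulAction Γ X] [MeasurableSpace X]
    (μ : Measure X) : Prop :=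
  ∀ g : Γ, g ≠ 1 → ∀ᵐ x ∂μ, g • x ≠ x

/-- An isomorphism `(X, μ) ≃ (Y, ν)` of measure spaces, in the usual sense of isomorphism modulo
null sets: measure preserving maps in both directions that are inverse to each other almost
everywhere. An automorphism of `(X, μ)` is an element of `MeasureIso μ μ`. -/
structure MeasureIso {X : Type v} {Y : Type w} [MeasurableSpace X] [MeasurableSpace Y]
    (μ : Measure X) (ν : Measure Y) where
  toFun : X → Y
  invFun : Y → X
  measurePreserving_toFun : MeasurePreserving toFun μ ν
  measurePreserving_invFun : MeasurePreserving invFun ν μ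
  left_inv : ∀ᵐ x ∂μ, invFun (toFun x) = x
  right_inv : ∀ᵐ y ∂ν, toFun (invFun y) = y

instance {X : Type v} {Y : Type w} [MeasurableSpace X] [MeasurableSpace Y]
    (μ : Measure X) (ν : Measure Y) : CoeFun (MeasureIso μ ν) (fun _ => X → Y) :=
  ⟨MeasureIso.toFun⟩

/-- The inverse isomorphism. -/
def MeasureIso.symm {X : Type v} {Y : Type w} [MeasurableSpace X] [MeasurableSpace Y]
    {μ : Measure X} {ν : Measure Y} (θ : MeasureIso μ ν) : MeasureIso ν μ where
  toFun := θ.invFun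
  invFun := θ.toFun
  measurePreserving_toFun := θ.measurePreserving_invFun
  measurePreserving_invFun := θ.measurePreserving_toFun
  left_inv := θ.right_inv
  right_inv := θ.left_inv

/-- The distance `‖φ - ψ‖₂ = (2 - 2 τ(p))^{1/2}` between isomorphisms `φ, ψ` of the probability
space `(X, μ)` onto another one, where `τ(p) = μ {x | φ x = ψ x}` is the trace of the largest
projection `p` on which `φ` and `ψ` agree. -/
noncomputable def isoDist {X : Type v} {Y : Type w} [MeasurableSpace X] (μ : Measure X)
    (φ ψ : X → Y) : ℝ :=
  Real.sqrt (2 - 2 * μ.real {x | φ x = ψ x})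

/-- The actions `Γ ↷ (X, μ)` and `Λ ↷ (Y, ν)` are conjugate: some isomorphism of measure spaces
intertwines them, up to an isomorphism of the groups. -/
def Conjugate (Γ Λ : Type*) [Group Γ] [Group Λ] {X : Type v} {Y : Type w}
    [MulAction Γ X] [MulAction Λ Y] [MeasurableSpace X] [MeasurableSpace Y]
    (μ : Measure X) (ν : Measure Y) : Prop :=
  ∃ (δ : Γ ≃* Λ) (θ : MeasureIso μ ν), ∀ g : Γ, ∀ᵐ x ∂μ, θ (g • x) = δ g • θ x

/-- The actions `Γ ↷ (X, μ)` and `Λ ↷ (Y, ν)` are approximately conjugate: for some isomorphism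
`δ : Γ ≃ Λ` and some sequence of isomorphisms `θₙ : (X, μ) ≃ (Y, ν)` one has
`‖θₙ σ_g θₙ⁻¹ - ρ_{δ(g)}‖₂ → 0` for every `g`. -/
def AppConjugate (Γ Λ : Type*) [Group Γ] [Group Λ] {X : Type v} {Y : Type w}
    [MulAction Γ X] [MulAction Λ Y] [MeasurableSpace X] [MeasurableSpace Y]
    (μ : Measure X) (ν : Measure Y) : Prop :=
  ∃ (δ : Γ ≃* Λ) (θ : ℕ → MeasureIso μ ν), ∀ g : Γ,
    Tendsto (fun n => isoDist ν (fun y => θ n (g • (θ n).symm y)) (fun y => δ g • y))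
      atTop (𝓝 0)

/-!
Almost equivariant isomorphisms of actions of a property (T) group are close to equivariant ones,
for the following reason. Let `θ : (X, μ) ≃ (Y, ν)` be almost equivariant, and let `θ_k = k θ k⁻¹`
be its translates. The union of the graphs of the countably many `θ_k` is a subset of `X × Y`
invariant under the diagonal action of `Γ`, and it carries a σ-finite invariant measure `m`, the
counting measure on vertical sections integrated over `μ`, or equally the counting measure on
horizontal sections integrated over `ν` (`exists_isGraphMeasure`, `IsGraphMeasure.symm`,
`IsGraphMeasure.smulInvariantMeasure`). In `L²(m)` the indicator function of the graph of `θ` is a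
unit vector, and `g` moves it by exactly the distance from `θ σ_g θ⁻¹` to `ρ_g`. Property (T)
provides an invariant vector nearby, whose super-level set at `1 / 2` is an invariant set `A` close
to the graph of `θ` (`IsKazhdanBound.exists_invariant_set`).

Discarding the points of `A` that are not alone in their vertical and horizontal sections costs
little, because a second point of a section lies off the graph of `θ`; what is left is the graph of
an equivariant measure preserving isomorphism between invariant subsets of `X` and `Y`, which agrees
with `θ` on most of `X` (`IsKazhdanBound.exists_isEquivariantPartialIso`). If `X` is ergodic, this
partial isomorphism is defined almost everywhere; this gives the first assertion and, after
composing one action with an automorphism of `Γ`, the second. If `X = Y` with the same action,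
finiteness of the measure allows the partial isomorphism to be extended to an automorphism commuting
with the action (`IsEquivariantPartialIso.exists_extension`), which gives the third assertion.

Two reductions concern property (T) itself. A Kazhdan pair controls the distance of a vector to its
projection on the invariant vectors, by considering the representation on their orthogonal
complement; and `L²(m)` is separable, so that it can be moved to the universe of `Γ` by means of a
countable Hilbert basis (`HasPropertyT.exists_isKazhdanBound`).
-/

/-! ### Kazhdan sets -/

/-- `F` is a Kazhdan set with constant `C` for separable Hilbert spaces in the universe `v`: a
vector moved by at most `δ` by every element of `F` lies within `C * δ` of an invariant vector. -/
def IsKazhdanBound (Γ : Type u) [Group Γ] (F : Finset Γ) (C : ℝ) : Prop :=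
  ∀ (H : Type v) [NormedAddCommGroup H] [InnerProductSpace ℂ H] [CompleteSpace H]
    [TopologicalSpace.SeparableSpace H] (π : Γ →* (H ≃ₗᵢ[ℂ] H)) (ξ : H) (δ : ℝ), 0 ≤ δ →
      (∀ g ∈ F, ‖π g ξ - ξ‖ ≤ δ) → ∃ η : H, (∀ g : Γ, π g η = η) ∧ ‖ξ - η‖ ≤ C * δ

/-- The balls of radius `1 / 2` around the vectors of an orthonormal family are disjoint. -/
theorem Orthonormal.countable_of_separableSpace {H : Type v} [NormedAddCommGroup H]
    [InnerProductSpace ℂ H] [TopologicalSpace.SeparableSpace H] {ι : Type*} {e : ι → H}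
    (he : Orthonormal ℂ e) : Countable ι := by
  refine Pairwise.countable_of_isOpen_disjoint (s := fun i => Metric.ball (e i) (1 / 2)) ?_
    (fun i => Metric.isOpen_ball) (fun i => ⟨e i, Metric.mem_ball_self (by norm_num)⟩)
  intro i j hij
  refine Metric.ball_disjoint_ball ?_
  have h1 : ‖e i - e j‖ ^ 2 = 2 := by
    have h := @norm_sub_sq ℂ H _ _ _ (e i) (e j)
    rw [he.2 hij, he.1 i, he.1 j] at h
    rw [h]; simp; norm_num
  rw [dist_eq_norm]
  nlinarith [norm_nonneg (e i - e j)]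

theorem exists_linearIsometryEquiv_of_separableSpace (H : Type v) [NormedAddCommGroup H]
    [InnerProductSpace ℂ H] [CompleteSpace H] [TopologicalSpace.SeparableSpace H] :
    ∃ ι : Type u, Nonempty (H ≃ₗᵢ[ℂ] lp (fun _ : ι => ℂ) 2) := by
  obtain ⟨w, b, -⟩ := exists_hilbertBasis ℂ H
  have : Countable w := b.orthonormal.countable_of_separableSpace
  have : Small.{u} w := Countable.toSmall w
  let e : Shrink.{u} w ≃ w := (equivShrink.{u, v} w).symm
  have hr : Set.range (b ∘ e) = Set.range b := e.surjective.range_comp b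
  refine ⟨Shrink.{u} w, ⟨(HilbertBasis.mk (v := b ∘ e) (b.orthonormal.comp e e.injective) ?_).repr⟩⟩
  rw [hr, b.dense_span]

section invariants

variable {Γ : Type u} [Group Γ] {H : Type v} [NormedAddCommGroup H] [InnerProductSpace ℂ H]

/-- The closed subspace of vectors fixed by a unitary representation. -/
def invariantVectors (π : Γ →* (H ≃ₗᵢ[ℂ] H)) : Submodule ℂ H where
  carrier := {η | ∀ g, π g η = η}
  add_mem' := fun ha hb g => by rw [map_add, ha g, hb g]
  zero_mem' := fun g => map_zero _
  smul_mem' := fun c x hx g => by rw [map_smul, hx g]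

theorem isClosed_invariantVectors (π : Γ →* (H ≃ₗᵢ[ℂ] H)) :
    IsClosed (invariantVectors π : Set H) := by
  have : (invariantVectors π : Set H) = ⋂ g, {η | π g η = η} := by
    ext; simp [invariantVectors]
  rw [this]
  exact isClosed_iInter fun g => isClosed_eq (π g).continuous continuous_id

theorem map_mem_orthogonal_invariantVectors (π : Γ →* (H ≃ₗᵢ[ℂ] H)) (g : Γ) {ζ : H}
    (hζ : ζ ∈ (invariantVectors π)ᗮ) : π g ζ ∈ (invariantVectors π)ᗮ := by
  rw [Submodule.mem_orthogonal] at hζ ⊢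
  intro η hη
  rw [← hη g, LinearIsometryEquiv.inner_map_map]
  exact hζ η hη

/-- The restriction of a unitary representation to the orthogonal complement of its invariant
vectors. -/
def restrictOrthogonal (π : Γ →* (H ≃ₗᵢ[ℂ] H)) :
    Γ →* ((invariantVectors π)ᗮ ≃ₗᵢ[ℂ] (invariantVectors π)ᗮ) where
  toFun g :=
    { toFun := fun ζ => ⟨π g ζ, map_mem_orthogonal_invariantVectors π g ζ.2⟩
      invFun := fun ζ => ⟨π g⁻¹ ζ, map_mem_orthogonal_invariantVectors π g⁻¹ ζ.2⟩
      map_add' := fun a b => by ext; simp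
      map_smul' := fun c a => by ext; simp
      left_inv := fun ζ => by
        ext
        change (π g⁻¹ * π g) (ζ : H) = ζ
        rw [← map_mul]; simp
      right_inv := fun ζ => by
        ext
        change (π g * π g⁻¹) (ζ : H) = ζ
        rw [← map_mul]; simp
      norm_map' := fun ζ => (π g).norm_map ζ }
  map_one' := by ext; simp
  map_mul' a b := by ext; simp

end invariants

/-- A Kazhdan pair moves every vector of the orthogonal complement of the invariant vectors by a
definite proportion, so the distance from `ξ` to its projection is controlled. -/
theorem HasPropertyT.exists_isKazhdanBound_self {Γ : Type u} [Group Γ] (hT : HasPropertyT Γ) :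
    ∃ (Q : Finset Γ) (C : ℝ), 0 ≤ C ∧ IsKazhdanBound.{u, u} Γ Q C := by
  obtain ⟨Q, κ, hκ, h⟩ := hT
  refine ⟨Q, κ⁻¹, by positivity, ?_⟩
  intro H _ _ _ _ π ξ δ hδ hξ
  have : CompleteSpace (invariantVectors π) := (isClosed_invariantVectors π).completeSpace_coe
  obtain ⟨η, hη, ζ, hζ, rfl⟩ := (invariantVectors π).exists_add_mem_mem_orthogonal ξ
  refine ⟨η, hη, ?_⟩
  rw [add_sub_cancel_left]
  by_contra! hlt
  have hζ0 : (0 : ℝ) < ‖ζ‖ := lt_of_le_of_lt (by positivity) hlt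
  obtain ⟨⟨x, hx⟩, hx0, hxi⟩ := h (invariantVectors π)ᗮ (restrictOrthogonal π)
    ⟨⟨ζ, hζ⟩, by simpa [Subtype.ext_iff] using hζ0, fun g hg => by
      have h1 := hξ g hg
      rw [map_add, hη g, add_sub_add_left_eq_sub] at h1
      have h2 : δ < κ * ‖ζ‖ := by
        rwa [inv_mul_lt_iff₀ hκ] at hlt
      exact h1.trans_lt h2⟩
  refine hx0 (Subtype.ext ?_)
  have hxinv : x ∈ invariantVectors π := fun g => congrArg Subtype.val (hxi g)
  exact inner_self_eq_zero.mp (hx x hxinv)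

/-- A separable Hilbert space is isometric to `ℓ²` of an index set in any prescribed universe, so
Kazhdan bounds do not depend on the universe of the Hilbert spaces. -/
theorem IsKazhdanBound.change_universe {Γ : Type u} [Group Γ] {Q : Finset Γ} {C : ℝ}
    (h : IsKazhdanBound.{u, u} Γ Q C) : IsKazhdanBound.{u, v} Γ Q C := by
  intro H _ _ _ _ π ξ δ hδ hξ
  obtain ⟨ι, ⟨e⟩⟩ := exists_linearIsometryEquiv_of_separableSpace.{u, v} H
  have : TopologicalSpace.SeparableSpace (lp (fun _ : ι => ℂ) 2) :=
    e.surjective.denseRange.separableSpace e.continuous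
  let π' : Γ →* (lp (fun _ : ι => ℂ) 2 ≃ₗᵢ[ℂ] lp (fun _ : ι => ℂ) 2) :=
    { toFun := fun g => (e.symm.trans (π g)).trans e
      map_one' := by ext1; simp
      map_mul' := fun a b => by ext1; simp }
  obtain ⟨η, hη, hn⟩ := h _ π' (e ξ) δ hδ fun g hg => by
    have : π' g (e ξ) - e ξ = e (π g ξ - ξ) := by simp [π']
    rw [this, e.norm_map]
    exact hξ g hg
  refine ⟨e.symm η, fun g => ?_, ?_⟩
  · have h2 : e (π g (e.symm η)) = η := hη g
    exact e.injective (by rw [h2, e.apply_symm_apply])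
  · rwa [← e.norm_map, map_sub, e.apply_symm_apply]

/-- An element of word length `n` over `F` moves a vector by at most `n` times as much as the
elements of `F` do. -/
theorem exists_norm_map_sub_le_of_mem_closure {Γ : Type u} [Group Γ] {F : Finset Γ} {g : Γ}
    (hg : g ∈ Subgroup.closure (F : Set Γ)) :
    ∃ n : ℕ, ∀ (H : Type v) [NormedAddCommGroup H] [InnerProductSpace ℂ H]
      (π : Γ →* (H ≃ₗᵢ[ℂ] H)) (ξ : H) (δ : ℝ),
      (∀ f ∈ F, ‖π f ξ - ξ‖ ≤ δ) → ‖π g ξ - ξ‖ ≤ n * δ := by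
  induction hg using Subgroup.closure_induction with
  | mem x hx => exact ⟨1, fun H _ _ π ξ δ h => by simpa using h x hx⟩
  | one => exact ⟨0, fun H _ _ π ξ δ h => by simp⟩
  | mul x y _ _ hx hy =>
    obtain ⟨n, hn⟩ := hx
    obtain ⟨m, hm⟩ := hy
    refine ⟨n + m, fun H _ _ π ξ δ h => ?_⟩
    have e : π (x * y) ξ - ξ = π x (π y ξ - ξ) + (π x ξ - ξ) := by simp
    rw [e]
    refine (norm_add_le _ _).trans ?_
    rw [LinearIsometryEquiv.norm_map]
    push_cast
    linarith [hn H π ξ δ h, hm H π ξ δ h]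
  | inv x _ hx =>
    obtain ⟨n, hn⟩ := hx
    refine ⟨n, fun H _ _ π ξ δ h => ?_⟩
    have e : π x⁻¹ ξ - ξ = - π x⁻¹ (π x ξ - ξ) := by
      have : π x⁻¹ (π x ξ) = ξ := by
        change (π x⁻¹ * π x) ξ = ξ
        rw [← map_mul]; simp
      rw [map_sub, this]; abel
    rw [e, norm_neg, LinearIsometryEquiv.norm_map]
    exact hn H π ξ δ h

/-- Any finite generating set is a Kazhdan set, with a worse constant. -/
theorem IsKazhdanBound.of_closure_eq_top {Γ : Type u} [Group Γ] {Q : Finset Γ} {C : ℝ}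
    (hC : 0 ≤ C) (h : IsKazhdanBound.{u, v} Γ Q C) {F : Finset Γ}
    (hF : Subgroup.closure (F : Set Γ) = ⊤) :
    ∃ C', 0 ≤ C' ∧ IsKazhdanBound.{u, v} Γ F C' := by
  choose n hn using fun g : Γ =>
    exists_norm_map_sub_le_of_mem_closure.{u, v} (F := F) (g := g) (hF ▸ Subgroup.mem_top g)
  refine ⟨C * (Q.sup n : ℕ), by positivity, fun H _ _ _ _ π ξ δ hδ hξ => ?_⟩
  rw [mul_assoc]
  refine h H π ξ _ (by positivity) fun g hg => (hn g H π ξ δ hξ).trans ?_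
  gcongr
  exact Finset.le_sup hg

/-- In a group with property (T) there is a finite Kazhdan set in every universe. -/
theorem HasPropertyT.exists_isKazhdanBound {Γ : Type u} [Group Γ] (hT : HasPropertyT Γ) :
    ∃ (Q : Finset Γ) (C : ℝ), 0 ≤ C ∧ IsKazhdanBound.{u, v} Γ Q C := by
  obtain ⟨Q, C, hC, h⟩ := hT.exists_isKazhdanBound_self
  exact ⟨Q, C, hC, h.change_universe⟩

/-! ### Measures on countable unions of graphs -/

/-- Measures that agree on the overlaps of countably many sets glue to one measure carried by the
union of these sets. -/
theorem exists_measure_restrict_eq_of_compatible {Z ι : Type*} [MeasurableSpace Z] [Countable ι]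
    {G : ι → Set Z} (hG : ∀ i, MeasurableSet (G i)) {ρ : ι → Measure Z}
    (h : ∀ i j, (ρ i).restrict (G i ∩ G j) = (ρ j).restrict (G i ∩ G j)) :
    ∃ m : Measure Z, (∀ i, m.restrict (G i) = (ρ i).restrict (G i)) ∧ m (⋃ i, G i)ᶜ = 0 := by
  rcases isEmpty_or_nonempty ι with hι | hι
  · exact ⟨0, fun i => isEmptyElim i, rfl⟩
  obtain ⟨e, he⟩ := exists_surjective_nat ι
  have hD : ∀ n, MeasurableSet (disjointed (fun n => G (e n)) n) :=
    fun n => MeasurableSet.disjointed (fun n => hG (e n)) n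
  have hDG : ∀ n, disjointed (fun n => G (e n)) n ⊆ G (e n) := disjointed_subset _
  have hU : (⋃ n, disjointed (fun n => G (e n)) n) = ⋃ i, G i := by
    rw [iUnion_disjointed]
    exact he.iUnion_comp G
  refine ⟨Measure.sum fun n => (ρ (e n)).restrict (disjointed (fun n => G (e n)) n),
    fun i => ?_, ?_⟩
  · rw [Measure.restrict_sum _ (hG i)]
    have key : ∀ n, ((ρ (e n)).restrict (disjointed (fun n => G (e n)) n)).restrict (G i) =
        ((ρ i).restrict (G i)).restrict (disjointed (fun n => G (e n)) n) := by
      intro n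
      have h1 : disjointed (fun n => G (e n)) n ∩ G i =
          (disjointed (fun n => G (e n)) n ∩ G i) ∩ (G (e n) ∩ G i) := by
        refine (Set.inter_eq_left.2 ?_).symm
        exact Set.inter_subset_inter_left _ (hDG n)
      rw [Measure.restrict_restrict (hG i), Measure.restrict_restrict (hD n), Set.inter_comm (G i),
        h1, ← Measure.restrict_restrict ((hD n).inter (hG i)), h (e n) i,
        Measure.restrict_restrict ((hD n).inter (hG i))]
    simp_rw [key]
    rw [← Measure.restrict_iUnion (disjoint_disjointed _) hD, hU,
      Measure.restrict_restrict (MeasurableSet.iUnion hG),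
      Set.inter_eq_right.2 (Set.subset_iUnion G i)]
  · rw [Measure.sum_apply _ (MeasurableSet.iUnion hG).compl]
    refine ENNReal.tsum_eq_zero.2 fun n => ?_
    rw [Measure.restrict_apply (MeasurableSet.iUnion hG).compl, ← hU]
    refine measure_mono_null ?_ measure_empty
    rintro x ⟨h1, h2⟩
    exact h1 (Set.mem_iUnion.2 ⟨n, h2⟩)

section graph

variable {X : Type v} {Y : Type w} [MeasurableSpace X] [MeasurableSpace Y]
  {μ : Measure X} {ν : Measure Y}

/-- The points of the graph of `θ` at which the two maps of `θ` are honestly inverse to each other.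
This is symmetric in `X` and `Y`. -/
def MeasureIso.graph (θ : MeasureIso μ ν) : Set (X × Y) :=
  {p | θ p.1 = p.2 ∧ θ.symm p.2 = p.1}

theorem MeasureIso.measurable (θ : MeasureIso μ ν) : Measurable θ :=
  θ.measurePreserving_toFun.measurable

theorem MeasureIso.measurable_prodMk (θ : MeasureIso μ ν) : Measurable fun x => (x, θ x) :=
  measurable_id.prodMk θ.measurable

theorem MeasureIso.measurableSet_graph [StandardBorelSpace X] [StandardBorelSpace Y]
    (θ : MeasureIso μ ν) : MeasurableSet θ.graph :=
  (measurableSet_eq_fun (θ.measurable.comp measurable_fst) measurable_snd).inter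
    (measurableSet_eq_fun (θ.symm.measurable.comp measurable_snd) measurable_fst)

theorem MeasureIso.ae_mem_graph (θ : MeasureIso μ ν) : ∀ᵐ x ∂μ, (x, θ x) ∈ θ.graph :=
  θ.left_inv.mono fun _ hx => ⟨rfl, hx⟩

theorem MeasureIso.swap_preimage_graph (θ : MeasureIso μ ν) :
    Prod.swap ⁻¹' θ.graph = θ.symm.graph := by
  ext ⟨y, x⟩
  exact and_comm

theorem MeasureIso.restrict_map_prodMk [StandardBorelSpace X] [StandardBorelSpace Y]
    (θ : MeasureIso μ ν) :
    (μ.map fun x => (x, θ x)).restrict θ.graph = μ.map fun x => (x, θ x) := by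
  rw [Measure.restrict_eq_self_of_ae_mem]
  exact (ae_map_iff θ.measurable_prodMk.aemeasurable θ.measurableSet_graph).2 θ.ae_mem_graph

theorem MeasureIso.map_swap_map_prodMk (θ : MeasureIso μ ν) :
    (μ.map fun x => (x, θ x)).map Prod.swap = ν.map fun y => (y, θ.symm y) := by
  have e : ν.map (fun y => (y, θ.symm y)) = (μ.map θ).map fun y => (y, θ.symm y) := by
    congr 1
    exact θ.measurePreserving_toFun.map_eq.symm
  rw [e, Measure.map_map measurable_swap θ.measurable_prodMk,
    Measure.map_map θ.symm.measurable_prodMk θ.measurable]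
  refine Measure.map_congr ?_
  filter_upwards [θ.left_inv] with x hx
  exact Prod.ext rfl hx.symm

variable {ι : Type*}

/-- `m` is the measure on `X × Y` obtained by integrating over `μ` the counting measures of the
vertical sections of the union of the graphs of the isomorphisms `ψ i`. -/
structure IsGraphMeasure (ψ : ι → MeasureIso μ ν) (m : Measure (X × Y)) : Prop where
  restrict_graph : ∀ i, m.restrict (ψ i).graph = μ.map fun x => (x, ψ i x)
  compl_null : m (⋃ i, (ψ i).graph)ᶜ = 0

theorem IsGraphMeasure.measure_inter_graph {ψ : ι → MeasureIso μ ν} {m : Measure (X × Y)}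
    (h : IsGraphMeasure ψ m) (i : ι) {B : Set (X × Y)}
    (hB : MeasurableSet B) : m (B ∩ (ψ i).graph) = μ {x | (x, ψ i x) ∈ B} := by
  rw [← Measure.restrict_apply hB, h.restrict_graph, Measure.map_apply (ψ i).measurable_prodMk hB]
  rfl

theorem IsGraphMeasure.measure_graph {ψ : ι → MeasureIso μ ν} {m : Measure (X × Y)}
    (h : IsGraphMeasure ψ m) (i : ι) : m (ψ i).graph = μ Set.univ := by
  simpa using h.measure_inter_graph i MeasurableSet.univ

theorem MeasureIso.fst_image_eq {ψ : ι → MeasureIso μ ν} {C : Set (X × Y)}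
    (hC : C ⊆ ⋃ i, (ψ i).graph) :
    Prod.fst '' C = ⋃ i, {x | (x, ψ i x) ∈ C ∩ (ψ i).graph} := by
  ext x
  simp only [Set.mem_image, Prod.exists, exists_and_right, exists_eq_right, Set.mem_iUnion]
  constructor
  · rintro ⟨y, hy⟩
    obtain ⟨i, hi⟩ := Set.mem_iUnion.1 (hC hy)
    have e : ψ i x = y := hi.1
    exact ⟨i, Set.mem_ofPred.2 (e ▸ ⟨hy, e ▸ hi⟩)⟩
  · rintro ⟨i, hi⟩
    exact ⟨_, hi.1⟩

theorem IsGraphMeasure.sigmaFinite [Countable ι] [IsFiniteMeasure μ] {ψ : ι → MeasureIso μ ν}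
    {m : Measure (X × Y)} (h : IsGraphMeasure ψ m) :
    SigmaFinite m := by
  let S : Set (Set (X × Y)) :=
    insert (⋃ i, (ψ i).graph)ᶜ (Set.range fun i => (ψ i).graph)
  have hS : S.Countable := (Set.countable_range _).insert _
  refine Measure.sigmaFinite_of_countable hS ?_ ?_
  · rintro s (rfl | ⟨i, rfl⟩)
    · exact h.compl_null.trans_lt ENNReal.zero_lt_top
    · exact (h.measure_graph i).trans_lt (measure_lt_top μ _)
  · rw [Set.sUnion_insert, Set.sUnion_range, Set.compl_union_self]

variable [StandardBorelSpace X] [StandardBorelSpace Y]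

theorem exists_isGraphMeasure [Countable ι] (ψ : ι → MeasureIso μ ν) :
    ∃ m, IsGraphMeasure ψ m := by
  have hc : ∀ i j, (μ.map fun x => (x, ψ i x)).restrict ((ψ i).graph ∩ (ψ j).graph) =
      (μ.map fun x => (x, ψ j x)).restrict ((ψ i).graph ∩ (ψ j).graph) := by
    intro i j
    have hm := (ψ i).measurableSet_graph.inter (ψ j).measurableSet_graph
    refine Measure.ext fun B hB => ?_
    rw [Measure.restrict_apply hB, Measure.restrict_apply hB,
      Measure.map_apply (ψ i).measurable_prodMk (hB.inter hm),
      Measure.map_apply (ψ j).measurable_prodMk (hB.inter hm)]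
    apply congrArg
    ext x
    constructor
    · rintro ⟨hb, h1, h2⟩
      have e : ψ j x = ψ i x := h2.1
      exact Set.mem_preimage.2 (e ▸ ⟨hb, h1, h2⟩)
    · rintro ⟨hb, h1, h2⟩
      have e : ψ i x = ψ j x := h1.1
      exact Set.mem_preimage.2 (e ▸ ⟨hb, h1, h2⟩)
  obtain ⟨m, h1, h2⟩ := exists_measure_restrict_eq_of_compatible
    (fun i => (ψ i).measurableSet_graph) hc
  exact ⟨m, fun i => (h1 i).trans (ψ i).restrict_map_prodMk, h2⟩

namespace IsGraphMeasure

variable {ψ : ι → MeasureIso μ ν} {m : Measure (X × Y)}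

/-- The definition of `m` is symmetric in `X` and `Y`: the horizontal sections can be counted
instead, since the `ψ i` preserve measures. -/
theorem symm [Countable ι] (h : IsGraphMeasure ψ m) :
    IsGraphMeasure (fun i => (ψ i).symm) (m.map Prod.swap) where
  restrict_graph i := by
    rw [Measure.restrict_map measurable_swap (ψ i).symm.measurableSet_graph,
      MeasureIso.swap_preimage_graph]
    exact (congrArg (Measure.map Prod.swap) (h.restrict_graph i)).trans (ψ i).map_swap_map_prodMk
  compl_null := by
    rw [Measure.map_apply measurable_swap
      (MeasurableSet.iUnion fun i => (ψ i).symm.measurableSet_graph).compl]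
    convert h.compl_null using 2
    simp only [Set.preimage_compl, Set.preimage_iUnion, MeasureIso.swap_preimage_graph]
    rfl

theorem measurableSet_section {C : Set (X × Y)} (hCm : MeasurableSet C) (i : ι) :
    MeasurableSet {x | (x, ψ i x) ∈ C ∩ (ψ i).graph} :=
  (ψ i).measurable_prodMk (hCm.inter (ψ i).measurableSet_graph)

theorem measurableSet_fst_image [Countable ι] {C : Set (X × Y)} (hCm : MeasurableSet C)
    (hC : C ⊆ ⋃ i, (ψ i).graph) : MeasurableSet (Prod.fst '' C) := by
  rw [MeasureIso.fst_image_eq hC]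
  exact MeasurableSet.iUnion fun i => measurableSet_section hCm i

theorem map_fst_restrict_inter_graph (h : IsGraphMeasure ψ m) {C : Set (X × Y)}
    (hCm : MeasurableSet C) (i : ι) :
    (m.restrict (C ∩ (ψ i).graph)).map Prod.fst =
      μ.restrict {x | (x, ψ i x) ∈ C ∩ (ψ i).graph} := by
  have hm := hCm.inter (ψ i).measurableSet_graph
  have e : m.restrict (C ∩ (ψ i).graph) =
      (m.restrict (ψ i).graph).restrict (C ∩ (ψ i).graph) := by
    rw [Measure.restrict_restrict hm, Set.inter_assoc, Set.inter_self]
  rw [e, h.restrict_graph, Measure.restrict_map (ψ i).measurable_prodMk hm,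
    Measure.map_map measurable_fst (ψ i).measurable_prodMk]
  exact Measure.map_id

/-- Every vertical section over the projection of `C` counts at least once. -/
theorem measure_fst_image_le [Countable ι] (h : IsGraphMeasure ψ m) {C : Set (X × Y)}
    (hCm : MeasurableSet C) (hC : C ⊆ ⋃ i, (ψ i).graph) : μ (Prod.fst '' C) ≤ m C := by
  rcases isEmpty_or_nonempty ι with hι | hι
  · have : C = ∅ := by simpa using hC
    simp [this]
  obtain ⟨e, he⟩ := exists_surjective_nat ι
  set V : ℕ → Set X := fun n => {x | (x, ψ (e n) x) ∈ C ∩ (ψ (e n)).graph}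
  have hV : ∀ n, MeasurableSet (V n) := fun n => measurableSet_section hCm (e n)
  have hD : ∀ n, MeasurableSet (disjointed V n) := fun n => MeasurableSet.disjointed hV n
  have hU : Prod.fst '' C = ⋃ n, disjointed V n := by
    rw [iUnion_disjointed, MeasureIso.fst_image_eq hC]
    exact (he.iUnion_comp (fun i => {x | (x, ψ i x) ∈ C ∩ (ψ i).graph})).symm
  have hle : ∀ n, μ (disjointed V n) ≤ ((m.restrict C).map Prod.fst) (disjointed V n) := by
    intro n
    have h1 := congrArg (fun ρ => ρ (disjointed V n)) (h.map_fst_restrict_inter_graph hCm (e n))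
    simp only [Measure.restrict_apply (hD n)] at h1
    rw [Set.inter_eq_left.2 (show disjointed V n ⊆ V n from disjointed_subset V n)] at h1
    rw [← h1]
    exact Measure.map_mono (Measure.restrict_mono Set.inter_subset_left le_rfl) measurable_fst _
  calc μ (Prod.fst '' C) = ∑' n, μ (disjointed V n) := by
        rw [hU, measure_iUnion (disjoint_disjointed V) hD]
    _ ≤ ∑' n, ((m.restrict C).map Prod.fst) (disjointed V n) := ENNReal.tsum_le_tsum hle
    _ = ((m.restrict C).map Prod.fst) (⋃ n, disjointed V n) :=
        (measure_iUnion (disjoint_disjointed V) hD).symm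
    _ ≤ ((m.restrict C).map Prod.fst) Set.univ := measure_mono (Set.subset_univ _)
    _ = m C := by rw [Measure.map_apply measurable_fst MeasurableSet.univ]; simp

/-- If every vertical section of `C` has at most one point, then `m` on `C` projects onto `μ` on the
projection of `C`. -/
theorem map_fst_restrict [Countable ι] (h : IsGraphMeasure ψ m) {C : Set (X × Y)}
    (hCm : MeasurableSet C) (hC : C ⊆ ⋃ i, (ψ i).graph) (hinj : Set.InjOn Prod.fst C) :
    (m.restrict C).map Prod.fst = μ.restrict (Prod.fst '' C) := by
  have hF := MeasureIso.fst_image_eq hC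
  have hV : ∀ i, MeasurableSet {x | (x, ψ i x) ∈ C ∩ (ψ i).graph} :=
    fun i => measurableSet_section hCm i
  have hFm := measurableSet_fst_image hCm hC
  have h1 : ((m.restrict C).map Prod.fst).restrict (Prod.fst '' C) =
      (m.restrict C).map Prod.fst := by
    rw [Measure.restrict_map measurable_fst hFm, Measure.restrict_restrict (measurable_fst hFm),
      Set.inter_eq_right.2 (Set.subset_preimage_image _ _)]
  rw [← h1, hF, Measure.restrict_iUnion_congr]
  intro i
  rw [← h.map_fst_restrict_inter_graph hCm i, Measure.restrict_map measurable_fst (hV i),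
    Measure.restrict_restrict (measurable_fst (hV i))]
  congr 2
  ext ⟨x, y⟩
  constructor
  · rintro ⟨h2, h3⟩
    have e : (x, ψ i x) = (x, y) := hinj h2.1 h3 rfl
    exact ⟨h3, e ▸ h2.2⟩
  · rintro ⟨h2, h3⟩
    have e : ψ i x = y := h3.1
    refine ⟨?_, h2⟩
    change (x, ψ i x) ∈ C ∩ (ψ i).graph
    rw [e]
    exact ⟨h2, h3⟩

end IsGraphMeasure

end graph

/-! ### The unitary representation attached to an isomorphism of two actions -/

instance Prod.measurableConstSMul {Γ : Type u} {X : Type v} {Y : Type w} [SMul Γ X] [SMul Γ Y]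
    [MeasurableSpace X] [MeasurableSpace Y] [MeasurableConstSMul Γ X] [MeasurableConstSMul Γ Y] :
    MeasurableConstSMul Γ (X × Y) :=
  ⟨fun g => ((measurable_const_smul g).comp measurable_fst).prodMk
    ((measurable_const_smul g).comp measurable_snd)⟩

section translate

variable {Γ : Type u} [Group Γ] {X : Type v} {Y : Type w} [MeasurableSpace X] [MeasurableSpace Y]
  [MulAction Γ X] [MeasurableConstSMul Γ X] [MulAction Γ Y] [MeasurableConstSMul Γ Y]
  {μ : Measure X} {ν : Measure Y} [SMulInvariantMeasure Γ X μ] [SMulInvariantMeasure Γ Y ν]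

/-- The translate `ρ_g θ σ_g⁻¹` of an isomorphism `θ` between two `Γ`-actions `σ` and `ρ`. -/
def MeasureIso.translate (θ : MeasureIso μ ν) (g : Γ) : MeasureIso μ ν where
  toFun x := g • θ (g⁻¹ • x)
  invFun y := g • θ.symm (g⁻¹ • y)
  measurePreserving_toFun := (measurePreserving_smul g ν).comp
    (θ.measurePreserving_toFun.comp (measurePreserving_smul g⁻¹ μ))
  measurePreserving_invFun := (measurePreserving_smul g μ).comp
    (θ.measurePreserving_invFun.comp (measurePreserving_smul g⁻¹ ν))
  left_inv := by
    filter_upwards [(measurePreserving_smul g⁻¹ μ).quasiMeasurePreserving.ae θ.left_inv] with x hx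
    rw [inv_smul_smul]
    exact (congrArg (g • ·) hx).trans (smul_inv_smul g x)
  right_inv := by
    filter_upwards [(measurePreserving_smul g⁻¹ ν).quasiMeasurePreserving.ae θ.right_inv] with y hy
    rw [inv_smul_smul]
    exact (congrArg (g • ·) hy).trans (smul_inv_smul g y)

theorem MeasureIso.translate_apply (θ : MeasureIso μ ν) (g : Γ) (x : X) :
    θ.translate g x = g • θ (g⁻¹ • x) := rfl

theorem MeasureIso.graph_translate (θ : MeasureIso μ ν) (g : Γ) :
    (θ.translate g).graph = (g⁻¹ • · : X × Y → X × Y) ⁻¹' θ.graph := by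
  ext ⟨x, y⟩
  change (g • θ (g⁻¹ • x) = y ∧ g • θ.symm (g⁻¹ • y) = x) ↔
    (θ (g⁻¹ • x) = g⁻¹ • y ∧ θ.symm (g⁻¹ • y) = g⁻¹ • x)
  simp only [← eq_inv_smul_iff]

theorem MeasureIso.graph_translate_one (θ : MeasureIso μ ν) :
    (θ.translate (1 : Γ)).graph = θ.graph := by
  rw [graph_translate]
  simp

theorem MeasureIso.smul_preimage_graph_translate (θ : MeasureIso μ ν) (g k : Γ) :
    (g • · : X × Y → X × Y) ⁻¹' (θ.translate k).graph = (θ.translate (g⁻¹ * k)).graph := by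
  simp only [graph_translate, Set.preimage_preimage, mul_inv_rev, inv_inv, mul_smul]

theorem MeasureIso.smul_mem_iUnion_graph (θ : MeasureIso μ ν) (g : Γ) (p : X × Y) :
    g • p ∈ ⋃ k : Γ, (θ.translate k).graph ↔ p ∈ ⋃ k : Γ, (θ.translate k).graph := by
  change p ∈ (g • · : X × Y → X × Y) ⁻¹' (⋃ k : Γ, (θ.translate k).graph) ↔ _
  rw [Set.preimage_iUnion]
  simp only [smul_preimage_graph_translate]
  rw [(Group.mulLeft_bijective g⁻¹).surjective.iUnion_comp fun k => (θ.translate k).graph]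

variable [Countable Γ] [StandardBorelSpace X] [StandardBorelSpace Y]

/-- The measure carried by the graphs of all translates of `θ` is invariant under the diagonal
action: this action permutes the graphs. -/
theorem IsGraphMeasure.smulInvariantMeasure {θ : MeasureIso μ ν} {m : Measure (X × Y)}
    (h : IsGraphMeasure (fun k : Γ => θ.translate k) m) : SMulInvariantMeasure Γ (X × Y) m := by
  have hG : ∀ k : Γ, MeasurableSet (θ.translate k).graph :=
    fun k => (θ.translate k).measurableSet_graph
  have hU := MeasurableSet.iUnion hG
  have hmap : ∀ g : Γ, m.map (g • ·) = m := by
    intro g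
    have hg : Measurable (g • · : X × Y → X × Y) := measurable_const_smul g
    have hUg : (g • · : X × Y → X × Y) ⁻¹' (⋃ k : Γ, (θ.translate k).graph) =
        ⋃ k : Γ, (θ.translate k).graph := Set.ext fun p => θ.smul_mem_iUnion_graph g p
    have h1 : m.restrict (⋃ k : Γ, (θ.translate k).graph) = m :=
      Measure.restrict_eq_self_of_ae_mem h.compl_null
    have h2 : (m.map (g • ·)).restrict (⋃ k : Γ, (θ.translate k).graph) = m.map (g • ·) := by
      rw [Measure.restrict_map hg hU, hUg, h1]
    rw [← h2]
    refine Eq.trans ?_ h1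
    rw [Measure.restrict_iUnion_congr]
    intro k
    rw [Measure.restrict_map hg (hG k), θ.smul_preimage_graph_translate, h.restrict_graph,
      h.restrict_graph, Measure.map_map hg (θ.translate (g⁻¹ * k)).measurable_prodMk]
    have e : ((g • · : X × Y → X × Y) ∘ fun x => (x, θ.translate (g⁻¹ * k) x)) =
        (fun x => (x, θ.translate k x)) ∘ (g • · : X → X) := by
      ext1 x
      simp [MeasureIso.translate_apply, mul_smul]
    rw [e, ← Measure.map_map (θ.translate k).measurable_prodMk (measurable_const_smul g),
      (measurePreserving_smul g μ).map_eq]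
  refine ⟨fun g s hs => ?_⟩
  rw [← Measure.map_apply (measurable_const_smul g) hs, hmap]

omit [StandardBorelSpace X] [Countable Γ] in
/-- The distance from `θ σ_g θ⁻¹` to `ρ_g`, expressed through the agreement of `θ` with its translate
by `g⁻¹`. -/
theorem MeasureIso.isoDist_sq [IsProbabilityMeasure μ] [IsProbabilityMeasure ν]
    (θ : MeasureIso μ ν) (g : Γ) :
    isoDist ν (fun y => θ (g • θ.symm y)) (fun y => g • y) ^ 2 =
      2 - 2 * μ.real {x | θ.translate g⁻¹ x = θ x} := by
  have hm : MeasurableSet {y | θ (g • θ.symm y) = g • y} :=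
    measurableSet_eq_fun
      (θ.measurable.comp ((measurable_const_smul g).comp θ.symm.measurable))
      (measurable_const_smul g)
  have e : ν.real {y | θ (g • θ.symm y) = g • y} = μ.real {x | θ.translate g⁻¹ x = θ x} := by
    rw [measureReal_def, ← θ.measurePreserving_toFun.measure_preimage hm.nullMeasurableSet,
      measureReal_def]
    congr 1
    refine measure_congr ?_
    filter_upwards [θ.left_inv] with x hx
    have hx' : θ.symm (θ x) = x := hx
    refine propext ?_
    change θ (g • θ.symm (θ x)) = g • θ x ↔ g⁻¹ • θ (g⁻¹⁻¹ • x) = θ x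
    rw [hx', inv_inv, inv_smul_eq_iff]
  rw [isoDist, Real.sq_sqrt, e]
  linarith [measureReal_le_one (μ := ν) (s := {y | θ (g • θ.symm y) = g • y})]

end translate

/-- The unitary representation `(π_g f)(x) = f(g⁻¹ x)` on `L²` attached to a measure preserving
action. -/
noncomputable def koopman (Γ : Type u) [Group Γ] {Z : Type v} [MeasurableSpace Z] [MulAction Γ Z]
    [MeasurableConstSMul Γ Z] (m : Measure Z) [SMulInvariantMeasure Γ Z m] :
    Γ →* (Lp ℂ 2 m ≃ₗᵢ[ℂ] Lp ℂ 2 m) where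
  toFun g :=
    { toFun := fun f => DomMulAct.mk g⁻¹ • f
      invFun := fun f => DomMulAct.mk g • f
      map_add' := fun f f' => smul_add _ f f'
      map_smul' := fun c f => smul_comm _ c f
      left_inv := fun f => by simp
      right_inv := fun f => by simp
      norm_map' := fun f => DomMulAct.norm_smul_Lp _ f }
  map_one' := by
    ext1 f
    change DomMulAct.mk (1 : Γ)⁻¹ • f = f
    rw [inv_one, DomMulAct.mk_one, one_smul]
  map_mul' a b := by
    ext1 f
    change DomMulAct.mk (a * b)⁻¹ • f = DomMulAct.mk a⁻¹ • DomMulAct.mk b⁻¹ • f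
    rw [← mul_smul, mul_inv_rev, DomMulAct.mk_mul]

theorem koopman_apply {Γ : Type u} [Group Γ] {Z : Type v} [MeasurableSpace Z] [MulAction Γ Z]
    [MeasurableConstSMul Γ Z] {m : Measure Z} [SMulInvariantMeasure Γ Z m] (g : Γ)
    (f : Lp ℂ 2 m) : koopman Γ m g f = DomMulAct.mk g⁻¹ • f := rfl

theorem norm_indicatorConstLp_sub_sq {Z : Type v} [MeasurableSpace Z] {m : Measure Z}
    {s t : Set Z} (hs : MeasurableSet s) (ht : MeasurableSet t) (hms : m s ≠ ⊤) (hmt : m t ≠ ⊤) :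
    ‖indicatorConstLp 2 hs hms (1 : ℂ) - indicatorConstLp 2 ht hmt (1 : ℂ)‖ ^ 2 =
      m.real s + m.real t - 2 * m.real (s ∩ t) := by
  have hn : ∀ {r : Set Z} (hr : MeasurableSet r) (hmr : m r ≠ ⊤),
      ‖indicatorConstLp 2 hr hmr (1 : ℂ)‖ ^ 2 = m.real r := by
    intro r hr hmr
    rw [norm_indicatorConstLp (by norm_num) (by norm_num)]
    rw [norm_one, one_mul, ← Real.rpow_natCast, ← Real.rpow_mul measureReal_nonneg]
    norm_num
  rw [@norm_sub_sq ℂ, hn, hn, L2.inner_indicatorConstLp_indicatorConstLp]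
  simp
  ring

/-- A function in `L²(m)` invariant under a countable group and close to the indicator of `D` has
an invariant super-level set close to `D`. -/
theorem exists_invariant_set_of_invariant_Lp {Γ : Type u} [Group Γ] [Countable Γ] {Z : Type v}
    [MeasurableSpace Z] [MulAction Γ Z] [MeasurableConstSMul Γ Z] {m : Measure Z}
    [SMulInvariantMeasure Γ Z m] {D : Set Z} (hD : MeasurableSet D) (hmD : m D ≠ ⊤)
    (η : Lp ℂ 2 m) (hη : ∀ g : Γ, koopman Γ m g η = η) :
    ∃ A : Set Z, MeasurableSet A ∧ (∀ (g : Γ) (z : Z), g • z ∈ A ↔ z ∈ A) ∧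
      m (D \ A ∪ A \ D) ≤ ENNReal.ofReal (4 * ‖indicatorConstLp 2 hD hmD (1 : ℂ) - η‖ ^ 2) := by
  set ξ := indicatorConstLp 2 hD hmD (1 : ℂ) with hξ
  have hηm : Measurable (η : Z → ℂ) := (Lp.stronglyMeasurable η).measurable
  set A₀ : Set Z := {z | 1 / 2 < ‖η z‖}
  have hA₀ : MeasurableSet A₀ := measurableSet_lt measurable_const hηm.norm
  have hinv : ∀ g : Γ, ∀ᵐ z ∂m, η (g • z) = η z := by
    intro g
    have h1 := DomMulAct.smul_Lp_ae_eq (DomMulAct.mk g) η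
    have h2 : DomMulAct.mk g • η = η := by
      have h3 := hη g⁻¹
      rwa [koopman_apply, inv_inv] at h3
    rw [h2] at h1
    filter_upwards [h1] with z hz
    exact hz.symm
  -- `A₀` is invariant up to null sets only; intersecting its translates makes it strictly invariant.
  refine ⟨{z | ∀ g : Γ, g • z ∈ A₀}, ?_, ?_, ?_⟩
  · rw [Set.ofPred_forall]
    exact MeasurableSet.iInter fun g => measurable_const_smul g hA₀
  · intro g z
    constructor
    · intro h k
      simpa [mul_smul] using h (k * g⁻¹)
    · intro h k
      rw [← mul_smul]
      exact h (k * g)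
  -- On the symmetric difference of `D` and the super-level set, `ξ` is `1` where `‖η‖ ≤ 1 / 2` and
  -- `0` where `‖η‖ > 1 / 2`, so `‖ξ - η‖ ≥ 1 / 2` there and Chebyshev's inequality applies.
  have hsub : ∀ᵐ z ∂m, z ∈ (D \ {z | ∀ g : Γ, g • z ∈ A₀}) ∪ ({z | ∀ g : Γ, g • z ∈ A₀} \ D) →
      z ∈ {z | (1 / 2 : ENNReal) ≤ ‖(ξ - η : Lp ℂ 2 m) z‖ₑ} := by
    filter_upwards [ae_all_iff.2 hinv, Lp.coeFn_sub ξ η,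
      indicatorConstLp_coeFn (p := 2) (hs := hD) (hμs := hmD) (c := (1 : ℂ))] with z h1 h2 h3 hz
    have hzA : (∀ g : Γ, g • z ∈ A₀) ↔ 1 / 2 < ‖η z‖ := by
      refine ⟨fun h => by simpa [A₀] using h 1, fun h g => ?_⟩
      change 1 / 2 < ‖η (g • z)‖
      rwa [h1 g]
    have key : (1 / 2 : ℝ) ≤ ‖(ξ - η : Lp ℂ 2 m) z‖ := by
      rw [h2, Pi.sub_apply, hξ, h3]
      rcases hz with ⟨hzD, hz⟩ | ⟨hz, hzD⟩
      · rw [Set.indicator_of_mem hzD]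
        have h4 : ¬ 1 / 2 < ‖η z‖ := fun h => hz (hzA.2 h)
        have h5 := norm_sub_norm_le (1 : ℂ) (η z)
        rw [norm_one] at h5
        linarith
      · rw [Set.indicator_of_notMem hzD, zero_sub, norm_neg]
        exact (hzA.1 hz).le
    change (1 / 2 : ENNReal) ≤ _
    rw [← ofReal_norm]
    refine le_trans (le_of_eq ?_) (ENNReal.ofReal_le_ofReal key)
    rw [ENNReal.ofReal_div_of_pos two_pos]
    simp
  refine (measure_mono_ae hsub).trans ?_
  have hM := meas_ge_le_mul_pow_eLpNorm_enorm m (p := 2) (by norm_num) (by norm_num)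
    (Lp.aestronglyMeasurable (ξ - η)) (ε := 1 / 2) (by norm_num) (by simp)
  refine hM.trans (le_of_eq ?_)
  rw [ENNReal.ofReal_mul (by norm_num), ENNReal.ofReal_pow (norm_nonneg _), Lp.norm_def,
    ENNReal.ofReal_toReal (Lp.eLpNorm_ne_top _)]
  congr 1
  · norm_num
  · norm_num

/-- If the isomorphism `θ` is almost equivariant on a Kazhdan set, then the indicator of its graph
is almost invariant in `L²` of the union of the translated graphs, hence close to an invariant
set. -/
theorem IsKazhdanBound.exists_invariant_set {Γ : Type u} [Group Γ] [Countable Γ]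
    {F : Finset Γ} {C : ℝ} (hF : IsKazhdanBound.{u, max v w} Γ F C)
    {X : Type v} {Y : Type w} [MeasurableSpace X]
    [MeasurableSpace Y] [MulAction Γ X] [MeasurableConstSMul Γ X] [MulAction Γ Y]
    [MeasurableConstSMul Γ Y] [StandardBorelSpace X] [StandardBorelSpace Y] {μ : Measure X}
    {ν : Measure Y} [IsProbabilityMeasure μ] [IsProbabilityMeasure ν] [SMulInvariantMeasure Γ X μ]
    [SMulInvariantMeasure Γ Y ν] {θ : MeasureIso μ ν} {m : Measure (X × Y)}
    (h : IsGraphMeasure (fun k : Γ => θ.translate k) m) {δ : ℝ} (hδ : 0 ≤ δ)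
    (hθ : ∀ g ∈ F, isoDist ν (fun y => θ (g • θ.symm y)) (fun y => g • y) ≤ δ) :
    ∃ A : Set (X × Y), MeasurableSet A ∧ (∀ (g : Γ) (z : X × Y), g • z ∈ A ↔ z ∈ A) ∧
      m (θ.graph \ A ∪ A \ θ.graph) ≤ ENNReal.ofReal (4 * (C * δ) ^ 2) := by
  have := h.smulInvariantMeasure
  have := h.sigmaFinite
  have hG : ∀ k : Γ, MeasurableSet (θ.translate k).graph :=
    fun k => (θ.translate k).measurableSet_graph
  have hD := θ.measurableSet_graph
  have hm1 : ∀ k : Γ, m (θ.translate k).graph = 1 := fun k => by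
    rw [h.measure_graph, measure_univ]
  have hmD1 : m θ.graph = 1 := θ.graph_translate_one (Γ := Γ) ▸ hm1 1
  have hmD : m θ.graph ≠ ⊤ := by rw [hmD1]; simp
  set ξ := indicatorConstLp 2 hD hmD (1 : ℂ) with hξ
  have hnorm : ∀ g : Γ, ‖koopman Γ m g ξ - ξ‖ =
      isoDist ν (fun y => θ (g • θ.symm y)) (fun y => g • y) := by
    intro g
    have hmg : MeasurableSet ((g • · : X × Y → X × Y) ⁻¹' θ.graph) := measurable_const_smul g hD
    have hgr : (g • · : X × Y → X × Y) ⁻¹' θ.graph = (θ.translate g⁻¹).graph := by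
      rw [MeasureIso.graph_translate, inv_inv]
    have e1 : ‖koopman Γ m g ξ - ξ‖ = ‖DomMulAct.mk g • ξ - ξ‖ := by
      rw [← norm_neg, neg_sub, ← (koopman Γ m g⁻¹).norm_map, map_sub]
      congr 2
      · change (koopman Γ m g⁻¹) ξ = _
        rw [koopman_apply, inv_inv]
      · change (koopman Γ m g⁻¹ * koopman Γ m g) ξ = ξ
        rw [← map_mul]
        simp
    have e2 : ‖DomMulAct.mk g • ξ - ξ‖ ^ 2 =
        isoDist ν (fun y => θ (g • θ.symm y)) (fun y => g • y) ^ 2 := by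
      rw [hξ, DomMulAct.mk_smul_indicatorConstLp, norm_indicatorConstLp_sub_sq,
        θ.isoDist_sq, measureReal_def, measureReal_def, measureReal_def, measureReal_def, hgr,
        hm1, hmD1, ← θ.graph_translate_one (Γ := Γ), h.measure_inter_graph 1 (hG g⁻¹)]
      have e3 : μ {x | (x, θ.translate (1 : Γ) x) ∈ (θ.translate g⁻¹).graph} =
          μ {x | θ.translate g⁻¹ x = θ x} := by
        refine measure_congr ?_
        filter_upwards [(θ.translate g⁻¹).left_inv] with x hx
        refine propext ?_
        have e4 : θ.translate (1 : Γ) x = θ x := by simp [MeasureIso.translate_apply]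
        change θ.translate g⁻¹ x = θ.translate (1 : Γ) x ∧
          (θ.translate g⁻¹).symm (θ.translate (1 : Γ) x) = x ↔ _
        rw [e4]
        exact ⟨fun h => h.1, fun h => ⟨h, h ▸ hx⟩⟩
      rw [e3]
      simp
      norm_num
    rw [e1]
    exact (pow_left_inj₀ (norm_nonneg _) (Real.sqrt_nonneg _) two_ne_zero).1 e2
  have : Fact ((2 : ENNReal) ≠ ⊤) := ⟨by norm_num⟩
  obtain ⟨η, hη, hn⟩ := hF (Lp ℂ 2 m) (koopman Γ m) ξ δ hδ fun g hg => (hnorm g).trans_le (hθ g hg)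
  obtain ⟨A, hA, hinv, hle⟩ := exists_invariant_set_of_invariant_Lp hD hmD η hη
  refine ⟨A, hA, hinv, hle.trans (ENNReal.ofReal_le_ofReal ?_)⟩
  gcongr

/-! ### Equivariant partial isomorphisms -/

/-- An equivariant, measure preserving isomorphism between invariant measurable subsets of two
`Γ`-spaces, together with measurable extensions of both maps to the whole spaces. -/
structure IsEquivariantPartialIso (Γ : Type u) [Group Γ] {X : Type v} {Y : Type w}
    [MeasurableSpace X] [MeasurableSpace Y] [MulAction Γ X] [MulAction Γ Y]
    (μ : Measure X) (ν : Measure Y) (e : PartialEquiv X Y) : Prop where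
  measurable_coe : Measurable e
  measurable_symm : Measurable e.symm
  measurableSet_source : MeasurableSet e.source
  measurableSet_target : MeasurableSet e.target
  map_restrict : (μ.restrict e.source).map e = ν.restrict e.target
  smul_mem : ∀ (g : Γ), ∀ x ∈ e.source, g • x ∈ e.source
  smul_apply : ∀ (g : Γ), ∀ x ∈ e.source, e (g • x) = g • e x

namespace IsEquivariantPartialIso

variable {Γ : Type u} [Group Γ] {X : Type*} {Y : Type*} {Z : Type*} [MeasurableSpace X]
  [MeasurableSpace Y] [MeasurableSpace Z] [MulAction Γ X] [MulAction Γ Y] [MulAction Γ Z]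
  {μ : Measure X} {ν : Measure Y} {ρ : Measure Z} {e : PartialEquiv X Y} {e' : PartialEquiv Y Z}

theorem measure_target (h : IsEquivariantPartialIso Γ μ ν e) : ν e.target = μ e.source := by
  have h1 := congrArg (fun m => m Set.univ) h.map_restrict
  simp only [Measure.map_apply h.measurable_coe MeasurableSet.univ] at h1
  simpa using h1.symm

theorem smul_mem_iff (h : IsEquivariantPartialIso Γ μ ν e) (g : Γ) (x : X) :
    g • x ∈ e.source ↔ x ∈ e.source :=
  ⟨fun hx => by simpa using h.smul_mem g⁻¹ _ hx, h.smul_mem g x⟩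

theorem smul_symm (h : IsEquivariantPartialIso Γ μ ν e) (g : Γ) {y : Y} (hy : y ∈ e.target) :
    g • y = e (g • e.symm y) := by
  rw [h.smul_apply g _ (e.map_target hy), e.right_inv hy]

theorem symm (h : IsEquivariantPartialIso Γ μ ν e) : IsEquivariantPartialIso Γ ν μ e.symm where
  measurable_coe := h.measurable_symm
  measurable_symm := h.measurable_coe
  measurableSet_source := h.measurableSet_target
  measurableSet_target := h.measurableSet_source
  map_restrict := by
    rw [e.symm_source, e.symm_target, ← h.map_restrict,
      Measure.map_map h.measurable_symm h.measurable_coe]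
    refine (Measure.map_congr ?_).trans Measure.map_id
    filter_upwards [ae_restrict_mem h.measurableSet_source] with x hx
    exact e.left_inv hx
  smul_mem g y hy := by
    rw [h.smul_symm g hy]
    exact e.map_source (h.smul_mem g _ (e.map_target hy))
  smul_apply g y hy := by
    rw [h.smul_symm g hy, e.left_inv (h.smul_mem g _ (e.map_target hy))]

theorem trans (h : IsEquivariantPartialIso Γ μ ν e) (h' : IsEquivariantPartialIso Γ ν ρ e') :
    IsEquivariantPartialIso Γ μ ρ (e.trans e') where
  measurable_coe := h'.measurable_coe.comp h.measurable_coe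
  measurable_symm := h.measurable_symm.comp h'.measurable_symm
  measurableSet_source := by
    rw [e.trans_source]
    exact h.measurableSet_source.inter (h.measurable_coe h'.measurableSet_source)
  measurableSet_target := by
    rw [e.trans_target]
    exact h'.measurableSet_target.inter (h'.measurable_symm h.measurableSet_target)
  map_restrict := by
    have h1 : (μ.restrict (e.trans e').source).map e = ν.restrict (e.target ∩ e'.source) := by
      rw [e.trans_source, Set.inter_comm,
        ← Measure.restrict_restrict (h.measurable_coe h'.measurableSet_source),
        ← Measure.restrict_map h.measurable_coe h'.measurableSet_source, h.map_restrict,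
        Measure.restrict_restrict h'.measurableSet_source, Set.inter_comm]
    have h2 : e.target ∩ e'.source = (e' ⁻¹' (e'.symm ⁻¹' e.target)) ∩ e'.source := by
      ext y
      refine and_congr_left fun hy => ?_
      rw [Set.mem_preimage, Set.mem_preimage, e'.left_inv hy]
    rw [PartialEquiv.coe_trans, ← Measure.map_map h'.measurable_coe h.measurable_coe, h1, h2,
      ← Measure.restrict_restrict
        (h'.measurable_coe (h'.measurable_symm h.measurableSet_target)),
      ← Measure.restrict_map h'.measurable_coe (h'.measurable_symm h.measurableSet_target),
      h'.map_restrict, Measure.restrict_restrict (h'.measurable_symm h.measurableSet_target),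
      e.trans_target, Set.inter_comm]
  smul_mem g x hx := by
    rw [e.trans_source] at hx ⊢
    refine ⟨h.smul_mem g x hx.1, ?_⟩
    rw [Set.mem_preimage, h.smul_apply g x hx.1]
    exact h'.smul_mem g _ hx.2
  smul_apply g x hx := by
    rw [e.trans_source] at hx
    rw [PartialEquiv.coe_trans, Function.comp_apply, Function.comp_apply,
      h.smul_apply g x hx.1, h'.smul_apply g _ hx.2]

theorem ofSet {s : Set X} (hs : MeasurableSet s) (hinv : ∀ (g : Γ), ∀ x ∈ s, g • x ∈ s) :
    IsEquivariantPartialIso Γ μ μ (PartialEquiv.ofSet s) where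
  measurable_coe := measurable_id
  measurable_symm := measurable_id
  measurableSet_source := hs
  measurableSet_target := hs
  map_restrict := Measure.map_id
  smul_mem := hinv
  smul_apply _ _ _ := rfl

theorem ofSet_compl_source (h : IsEquivariantPartialIso Γ μ ν e) :
    IsEquivariantPartialIso Γ μ μ (PartialEquiv.ofSet e.sourceᶜ) :=
  ofSet h.measurableSet_source.compl fun g x hx h' => hx ((h.smul_mem_iff g x).1 h')

/-- Countably many equivariant partial isomorphisms with disjoint domains exhausting `X` and
disjoint ranges glue to an equivariant isomorphism; the ranges exhaust `Y` because both spaces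
have the same finite mass. -/
theorem exists_measureIso {ι : Type*} [Countable ι] [Nonempty ι] [IsProbabilityMeasure μ]
    [IsProbabilityMeasure ν] {e : ι → PartialEquiv X Y}
    (he : ∀ i, IsEquivariantPartialIso Γ μ ν (e i))
    (hs : Pairwise (Function.onFun Disjoint fun i => (e i).source))
    (ht : Pairwise (Function.onFun Disjoint fun i => (e i).target))
    (hfull : ∀ᵐ x ∂μ, x ∈ ⋃ i, (e i).source) :
    ∃ θ : MeasureIso μ ν, (∀ i, Set.EqOn θ (e i) (e i).source) ∧
      ∀ g : Γ, ∀ᵐ x ∂μ, θ (g • x) = g • θ x := by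
  obtain ⟨f, hf, hfe⟩ := exists_measurable_piecewise (fun i => (e i).source)
    (fun i => (he i).measurableSet_source) (fun i => e i) (fun i => (he i).measurable_coe)
    (fun i j hij x hx => ((hs hij).le_bot hx).elim)
  obtain ⟨f', hf', hfe'⟩ := exists_measurable_piecewise (fun i => (e i).target)
    (fun i => (he i).measurableSet_target) (fun i => (e i).symm)
    (fun i => (he i).measurable_symm) (fun i j hij x hx => ((ht hij).le_bot hx).elim)
  have hmap : μ.map f = ν.restrict (⋃ i, (e i).target) := by
    have h1 : μ = Measure.sum fun i => μ.restrict (e i).source := by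
      rw [← Measure.restrict_iUnion hs fun i => (he i).measurableSet_source]
      exact (Measure.restrict_eq_self_of_ae_mem hfull).symm
    rw [Measure.restrict_iUnion ht fun i => (he i).measurableSet_target]
    conv_lhs => rw [h1]
    rw [Measure.map_sum hf.aemeasurable]
    congr 1
    ext1 i
    rw [← (he i).map_restrict]
    refine Measure.map_congr ?_
    filter_upwards [ae_restrict_mem (he i).measurableSet_source] with x hx
    exact hfe i hx
  have hfull' : ∀ᵐ y ∂ν, y ∈ ⋃ i, (e i).target := by
    have h1 := congrArg (fun m => m Set.univ) hmap
    simp only [Measure.map_apply hf MeasurableSet.univ, Set.preimage_univ, measure_univ,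
      Measure.restrict_apply_univ] at h1
    exact (prob_compl_eq_zero_iff
      (MeasurableSet.iUnion fun i => (he i).measurableSet_target)).2 h1.symm
  have hmp : MeasurePreserving f μ ν :=
    ⟨hf, hmap.trans (Measure.restrict_eq_self_of_ae_mem hfull')⟩
  have hleft : ∀ᵐ x ∂μ, f' (f x) = x := by
    filter_upwards [hfull] with x hx
    obtain ⟨i, hi⟩ := Set.mem_iUnion.1 hx
    have h1 : f x = e i x := hfe i hi
    rw [h1, hfe' i ((e i).map_source hi), (e i).left_inv hi]
  have hmp' : MeasurePreserving f' ν μ := by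
    refine ⟨hf', ?_⟩
    rw [← hmp.map_eq, Measure.map_map hf' hf]
    exact (Measure.map_congr hleft).trans Measure.map_id
  refine ⟨⟨f, f', hmp, hmp', hleft, ?_⟩, hfe, fun g => ?_⟩
  · filter_upwards [hfull'] with y hy
    obtain ⟨i, hi⟩ := Set.mem_iUnion.1 hy
    have h1 : f' y = (e i).symm y := hfe' i hi
    rw [h1, hfe i ((e i).map_target hi), (e i).right_inv hi]
  · filter_upwards [hfull] with x hx
    obtain ⟨i, hi⟩ := Set.mem_iUnion.1 hx
    rw [hfe i hi, hfe i ((he i).smul_mem g x hi), (he i).smul_apply g x hi]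

end IsEquivariantPartialIso

/-- The `n`-th iterate of the inverse of `e`, on its natural domain. -/
def PartialEquiv.backward {X : Type*} (e : PartialEquiv X X) : ℕ → PartialEquiv X X
  | 0 => PartialEquiv.refl X
  | n + 1 => (e.backward n).trans e.symm

/-- Backward orbits starting at different times outside the source of `e` never meet. -/
theorem PartialEquiv.mem_source_of_backward_eq {X : Type*} (e : PartialEquiv X X) (d : ℕ) {x z : X}
    (j : ℕ) (hx : x ∈ (e.backward j).source) (hz : z ∈ (e.backward (j + d + 1)).source)
    (h : e.backward j x = e.backward (j + d + 1) z) : x ∈ e.source := by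
  induction j with
  | zero =>
    change x = e.symm (e.backward (0 + d) z) at h
    rw [h]
    exact e.map_target hz.2
  | succ j ih =>
    rw [show j + 1 + d + 1 = (j + d + 1) + 1 by ring] at hz h
    exact ih hx.1 hz.1 (e.symm.injOn hx.2 hz.2 h)

/-- Restricting backward iterates to subsets of the complement of the source of `e` gives partial
isomorphisms with disjoint ranges. -/
theorem PartialEquiv.disjoint_target_backward {X : Type*} {e : PartialEquiv X X}
    {q : ℕ → PartialEquiv X X}
    (hq : ∀ n, ∀ x ∈ (q n).source, x ∉ e.source ∧ x ∈ (e.backward n).source)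
    (hqe : ∀ n, ⇑(q n) = e.backward n) :
    Pairwise (Function.onFun Disjoint fun n => (q n).target) := by
  rw [pairwise_disjoint_on]
  intro j k hjk
  obtain ⟨d, rfl⟩ := Nat.exists_eq_add_of_lt hjk
  rw [Set.disjoint_left]
  intro y hj hk
  have h1 := (q j).map_target hj
  have h2 := (q (j + d + 1)).map_target hk
  refine (hq j _ h1).1 (e.mem_source_of_backward_eq d j (hq j _ h1).2 (hq _ _ h2).2 ?_)
  rw [← hqe, ← hqe, (q j).right_inv hj, (q (j + d + 1)).right_inv hk]

namespace IsEquivariantPartialIso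

variable {Γ : Type u} [Group Γ] {X : Type*} [MeasurableSpace X] [MulAction Γ X] {μ : Measure X}
  {e : PartialEquiv X X}

theorem backward (h : IsEquivariantPartialIso Γ μ μ e) (n : ℕ) :
    IsEquivariantPartialIso Γ μ μ (e.backward n) := by
  induction n with
  | zero =>
    have h1 : e.backward 0 = PartialEquiv.ofSet Set.univ := rfl
    rw [h1]
    exact ofSet MeasurableSet.univ fun _ _ _ => Set.mem_univ _
  | succ n ih => exact ih.trans h.symm

/-- An equivariant partial isomorphism of a probability space with itself extends to an
equivariant automorphism: a point outside the source is sent to the first point of its backward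
orbit outside the target. Almost every such orbit does leave the target, since the points where it
does not have infinitely many disjoint images of the same measure. -/
theorem exists_extension [IsProbabilityMeasure μ] (h : IsEquivariantPartialIso Γ μ μ e) :
    ∃ θ : MeasureIso μ μ, Set.EqOn θ e e.source ∧ ∀ g : Γ, ∀ᵐ x ∂μ, θ (g • x) = g • θ x := by
  let q : ℕ → PartialEquiv X X := fun n =>
    ((PartialEquiv.ofSet e.sourceᶜ).trans (e.backward n)).trans (PartialEquiv.ofSet e.targetᶜ)
  have hq : ∀ n, IsEquivariantPartialIso Γ μ μ (q n) := fun n =>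
    (h.ofSet_compl_source.trans (h.backward n)).trans h.symm.ofSet_compl_source
  have hsrc : ∀ n x, x ∈ (q n).source ↔
      x ∉ e.source ∧ x ∈ (e.backward n).source ∧ e.backward n x ∉ e.target := by
    intro n x
    simp [q, PartialEquiv.trans_source, and_assoc]
  have htq : Pairwise (Function.onFun Disjoint fun n => (q n).target) :=
    PartialEquiv.disjoint_target_backward (fun n x hx => ⟨((hsrc n x).1 hx).1, ((hsrc n x).1 hx).2.1⟩)
      fun n => rfl
  have hmono : ∀ {j k : ℕ}, j < k → ∀ x, x ∈ (e.backward k).source →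
      x ∈ (e.backward j).source ∧ e.backward j x ∈ e.target := by
    intro j k hjk x hx
    induction k, hjk using Nat.le_induction with
    | base => exact hx
    | succ k _ ih => exact ih hx.1
  have hsq : Pairwise (Function.onFun Disjoint fun n => (q n).source) := by
    rw [pairwise_disjoint_on]
    intro j k hjk
    rw [Set.disjoint_left]
    intro x hj hk
    exact ((hsrc j x).1 hj).2.2 (hmono hjk x ((hsrc k x).1 hk).2.1).2
  -- the points whose backward orbit never leaves the target
  let s : Set X := e.sourceᶜ ∩ ⋂ n, (e.backward n).source
  have hs : MeasurableSet s := h.measurableSet_source.compl.inter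
    (MeasurableSet.iInter fun n => (h.backward n).measurableSet_source)
  have hsinv : ∀ (g : Γ), ∀ x ∈ s, g • x ∈ s := by
    rintro g x ⟨hx, hx'⟩
    refine ⟨fun h' => hx ((h.smul_mem_iff g x).1 h'), ?_⟩
    rw [Set.mem_iInter] at hx' ⊢
    exact fun n => (h.backward n).smul_mem g x (hx' n)
  have hs0 : μ s = 0 := by
    let r : ℕ → PartialEquiv X X := fun n => (PartialEquiv.ofSet s).trans (e.backward n)
    have hr : ∀ n, IsEquivariantPartialIso Γ μ μ (r n) :=
      fun n => (ofSet hs hsinv).trans (h.backward n)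
    have hrs : ∀ n, (r n).source = s := by
      intro n
      ext x
      simp only [r, PartialEquiv.trans_source, PartialEquiv.ofSet_source, PartialEquiv.ofSet_coe,
        Set.preimage_id_eq, id_eq]
      exact ⟨fun hx => hx.1, fun hx => ⟨hx, Set.mem_iInter.1 hx.2 n⟩⟩
    have hrt : Pairwise (Function.onFun Disjoint fun n => (r n).target) := by
      refine PartialEquiv.disjoint_target_backward (fun n x hx => ?_) fun n => rfl
      rw [hrs] at hx
      exact ⟨hx.1, Set.mem_iInter.1 hx.2 n⟩
    have hsum := measure_iUnion (μ := μ) hrt fun n => (hr n).measurableSet_target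
    have hconst : ∀ n, μ (r n).target = μ s := fun n => by rw [(hr n).measure_target, hrs]
    simp only [hconst] at hsum
    by_contra hne
    rw [ENNReal.tsum_const_eq_top_of_ne_zero hne] at hsum
    exact measure_ne_top μ _ hsum
  have hiso : ∀ i : Option ℕ, IsEquivariantPartialIso Γ μ μ (i.elim e q) := by
    rintro (_ | n)
    exacts [h, hq n]
  have hdisj : Pairwise (Function.onFun Disjoint fun i : Option ℕ => (i.elim e q).source) := by
    have h1 : ∀ n, Disjoint e.source (q n).source := fun n =>
      Set.disjoint_left.2 fun x hx hx' => ((hsrc n x).1 hx').1 hx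
    rintro (_ | j) (_ | k) hjk
    exacts [(hjk rfl).elim, h1 k, (h1 j).symm, hsq fun h' => hjk (congrArg some h')]
  have hdisj' : Pairwise (Function.onFun Disjoint fun i : Option ℕ => (i.elim e q).target) := by
    have h1 : ∀ n, Disjoint e.target (q n).target := fun n =>
      Set.disjoint_left.2 fun x hx hx' => by
        have h2 := (hsrc n _).1 ((q n).map_target hx')
        refine h2.2.2 ?_
        rwa [show e.backward n ((q n).symm x) = x from (q n).right_inv hx']
    rintro (_ | j) (_ | k) hjk
    exacts [(hjk rfl).elim, h1 k, (h1 j).symm, htq fun h' => hjk (congrArg some h')]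
  have hfull : ∀ᵐ x ∂μ, x ∈ ⋃ i : Option ℕ, (i.elim e q).source := by
    filter_upwards [measure_eq_zero_iff_ae_notMem.1 hs0] with x hx
    by_contra hnot
    rw [Set.mem_iUnion] at hnot
    push Not at hnot
    refine hx ⟨hnot none, Set.mem_iInter.2 fun n => ?_⟩
    induction n with
    | zero => exact Set.mem_univ x
    | succ n ih =>
      refine ⟨ih, ?_⟩
      by_contra hne
      exact hnot (some n) ((hsrc n x).2 ⟨hnot none, ih, hne⟩)
  obtain ⟨θ, hθ, hθg⟩ := exists_measureIso hiso hdisj hdisj' hfull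
  exact ⟨θ, hθ none, hθg⟩

end IsEquivariantPartialIso

/-! ### From an invariant set to an equivariant partial isomorphism -/

/-- The points of `X` over which `C` has at least two points. -/
def multiplePoints {X : Type v} {Y : Type w} (C : Set (X × Y)) : Set X :=
  {x | ∃ y y', y ≠ y' ∧ (x, y) ∈ C ∧ (x, y') ∈ C}

theorem multiplePoints_subset {X : Type v} {Y : Type w} {C D : Set (X × Y)}
    (hD : Set.InjOn Prod.fst D) : multiplePoints C ⊆ Prod.fst '' (C \ D) := by
  rintro x ⟨y, y', hne, hy, hy'⟩
  by_cases h : (x, y) ∈ D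
  · refine ⟨(x, y'), ⟨hy', fun h' => hne ?_⟩, rfl⟩
    exact congrArg Prod.snd (hD h h' rfl)
  · exact ⟨(x, y), ⟨hy, h⟩, rfl⟩

/-- The part of `C` that is a graph in both directions: the points which are alone in their
vertical and in their horizontal section. -/
def graphPart {X : Type v} {Y : Type w} (C : Set (X × Y)) : Set (X × Y) :=
  {p ∈ C | p.1 ∉ multiplePoints C ∧ p.2 ∉ multiplePoints (Prod.swap ⁻¹' C)}

theorem graphPart_subset {X : Type v} {Y : Type w} (C : Set (X × Y)) : graphPart C ⊆ C :=
  fun _ hp => hp.1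

theorem injOn_fst_graphPart {X : Type v} {Y : Type w} (C : Set (X × Y)) :
    Set.InjOn Prod.fst (graphPart C) := by
  rintro ⟨x, y⟩ h ⟨x', y'⟩ h' (rfl : x = x')
  by_contra hne
  exact h.2.1 ⟨y, y', fun e => hne (by rw [e]), h.1, h'.1⟩

theorem swap_preimage_graphPart {X : Type v} {Y : Type w} (C : Set (X × Y)) :
    Prod.swap ⁻¹' (graphPart C) = graphPart (Prod.swap ⁻¹' C) := by
  ext p
  exact and_congr_right fun _ => and_comm

theorem smul_mem_multiplePoints_iff {Γ : Type u} [Group Γ] {X : Type v} {Y : Type w}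
    [MulAction Γ X] [MulAction Γ Y] {C : Set (X × Y)}
    (hC : ∀ (g : Γ) (p : X × Y), g • p ∈ C ↔ p ∈ C) (g : Γ) (x : X) :
    g • x ∈ multiplePoints C ↔ x ∈ multiplePoints C := by
  have key : ∀ (g : Γ) (x : X), x ∈ multiplePoints C → g • x ∈ multiplePoints C := by
    rintro g x ⟨y, y', hne, hy, hy'⟩
    exact ⟨g • y, g • y', fun e => hne (smul_left_cancel g e), (hC g (x, y)).2 hy,
      (hC g (x, y')).2 hy'⟩
  exact ⟨fun h => by simpa using key g⁻¹ _ h, key g x⟩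

theorem smul_mem_graphPart_iff {Γ : Type u} [Group Γ] {X : Type v} {Y : Type w}
    [MulAction Γ X] [MulAction Γ Y] {C : Set (X × Y)}
    (hC : ∀ (g : Γ) (p : X × Y), g • p ∈ C ↔ p ∈ C) (g : Γ) (p : X × Y) :
    g • p ∈ graphPart C ↔ p ∈ graphPart C := by
  refine and_congr (hC g p) (and_congr (not_congr ?_) (not_congr ?_))
  · exact smul_mem_multiplePoints_iff hC g p.1
  · exact smul_mem_multiplePoints_iff (C := Prod.swap ⁻¹' C) (fun g q => hC g q.swap) g p.2

section

variable {X : Type v} {Y : Type w} [MeasurableSpace X] [MeasurableSpace Y] {μ : Measure X}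
  {ν : Measure Y} {ι : Type*} {ψ : ι → MeasureIso μ ν} {m : Measure (X × Y)} {C : Set (X × Y)}

theorem MeasureIso.injOn_fst_graph (θ : MeasureIso μ ν) : Set.InjOn Prod.fst θ.graph := by
  rintro ⟨x, y⟩ h ⟨x', y'⟩ h' (rfl : x = x')
  exact Prod.ext rfl (h.1.symm.trans h'.1)

theorem MeasureIso.swap_preimage_subset (hC : C ⊆ ⋃ i, (ψ i).graph) :
    Prod.swap ⁻¹' C ⊆ ⋃ i, (ψ i).symm.graph := by
  intro p hp
  obtain ⟨i, hi⟩ := Set.mem_iUnion.1 (hC hp)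
  exact Set.mem_iUnion.2 ⟨i, hi.2, hi.1⟩

variable [StandardBorelSpace X] [StandardBorelSpace Y] [Countable ι]

omit [StandardBorelSpace X] in
theorem MeasureIso.measurableSet_multiplePoints (hCm : MeasurableSet C)
    (hC : C ⊆ ⋃ i, (ψ i).graph) : MeasurableSet (multiplePoints C) := by
  have e : multiplePoints C = ⋃ i, ⋃ j, {x | (x, ψ i x) ∈ C} ∩ {x | (x, ψ j x) ∈ C} ∩
      {x | ψ i x = ψ j x}ᶜ := by
    ext x
    simp only [Set.mem_iUnion]
    constructor
    · rintro ⟨y, y', hne, hy, hy'⟩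
      obtain ⟨i, hi⟩ := Set.mem_iUnion.1 (hC hy)
      obtain ⟨j, hj⟩ := Set.mem_iUnion.1 (hC hy')
      obtain rfl : ψ i x = y := hi.1
      obtain rfl : ψ j x = y' := hj.1
      exact ⟨i, j, ⟨hy, hy'⟩, hne⟩
    · rintro ⟨i, j, ⟨hy, hy'⟩, hne⟩
      exact ⟨_, _, hne, hy, hy'⟩
  rw [e]
  exact MeasurableSet.iUnion fun i => MeasurableSet.iUnion fun j =>
    (((ψ i).measurable_prodMk hCm).inter ((ψ j).measurable_prodMk hCm)).inter
      (measurableSet_eq_fun (ψ i).measurable (ψ j).measurable).compl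

theorem MeasureIso.measurableSet_graphPart (hCm : MeasurableSet C)
    (hC : C ⊆ ⋃ i, (ψ i).graph) : MeasurableSet (graphPart C) :=
  hCm.inter ((measurable_fst (measurableSet_multiplePoints hCm hC)).compl.inter
    (measurable_snd (measurableSet_multiplePoints (measurable_swap hCm)
      (swap_preimage_subset hC))).compl)

omit [StandardBorelSpace X] [StandardBorelSpace Y] in
theorem MeasureIso.exists_measurable_of_injOn [Nonempty ι] (hCm : MeasurableSet C)
    (hC : C ⊆ ⋃ i, (ψ i).graph) (hinj : Set.InjOn Prod.fst C) :
    ∃ f : X → Y, Measurable f ∧ ∀ p ∈ C, f p.1 = p.2 := by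
  obtain ⟨f, hf, hfe⟩ := exists_measurable_piecewise (fun i => {x | (x, ψ i x) ∈ C})
    (fun i => (ψ i).measurable_prodMk hCm) (fun i => ψ i) (fun i => (ψ i).measurable)
    (fun i j _ x hx => congrArg Prod.snd (hinj hx.1 hx.2 rfl))
  refine ⟨f, hf, fun p hp => ?_⟩
  obtain ⟨i, hi⟩ := Set.mem_iUnion.1 (hC hp)
  have h1 : (p.1, ψ i p.1) = p := Prod.ext rfl hi.1
  exact (hfe i (show (p.1, ψ i p.1) ∈ C from h1.symm ▸ hp)).trans hi.1

namespace IsGraphMeasure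

/-- The points of a graph lying over the projection of `C` have measure at most `m C`. -/
theorem measure_graph_inter_fst_le (h : IsGraphMeasure ψ m) (i : ι) (hCm : MeasurableSet C)
    (hC : C ⊆ ⋃ i, (ψ i).graph) :
    m ((ψ i).graph ∩ Prod.fst ⁻¹' (Prod.fst '' C)) ≤ m C := by
  rw [Set.inter_comm, h.measure_inter_graph i (measurable_fst (measurableSet_fst_image hCm hC))]
  exact h.measure_fst_image_le hCm hC

theorem measure_graph_inter_snd_le (h : IsGraphMeasure ψ m) (i : ι) (hCm : MeasurableSet C)
    (hC : C ⊆ ⋃ i, (ψ i).graph) :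
    m ((ψ i).graph ∩ Prod.snd ⁻¹' (Prod.fst '' (Prod.swap ⁻¹' C))) ≤ m C := by
  have hC' := MeasureIso.swap_preimage_subset hC
  have h1 := h.symm.measure_graph_inter_fst_le i (measurable_swap hCm) hC'
  rw [Measure.map_apply measurable_swap (measurable_swap hCm), Measure.map_apply measurable_swap
    ((ψ i).symm.measurableSet_graph.inter
      (measurable_fst (measurableSet_fst_image (measurable_swap hCm) hC'))),
    Set.preimage_inter, MeasureIso.swap_preimage_graph] at h1
  exact h1

/-- Passing to the graph part of `C` loses few points of the graph of `ψ i`: if such a point is not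
alone in a section, then this section contains a point of `C` off the graph. -/
theorem measure_graph_sdiff_graphPart_le (h : IsGraphMeasure ψ m) (i : ι) (hCm : MeasurableSet C)
    (hC : C ⊆ ⋃ i, (ψ i).graph) :
    m ((ψ i).graph \ graphPart C) ≤ 3 * m ((ψ i).graph \ C ∪ C \ (ψ i).graph) := by
  have hEm : MeasurableSet (C \ (ψ i).graph) := hCm.diff (ψ i).measurableSet_graph
  have hE : C \ (ψ i).graph ⊆ ⋃ i, (ψ i).graph := Set.sdiff_subset.trans hC
  have hsub : (ψ i).graph \ graphPart C ⊆ ((ψ i).graph \ C) ∪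
      (((ψ i).graph ∩ Prod.fst ⁻¹' (Prod.fst '' (C \ (ψ i).graph))) ∪
      ((ψ i).graph ∩ Prod.snd ⁻¹' (Prod.fst '' (Prod.swap ⁻¹' (C \ (ψ i).graph))))) := by
    rintro p ⟨hp, hp'⟩
    by_cases hpC : p ∈ C
    · right
      by_cases h1 : p.1 ∈ multiplePoints C
      · exact Or.inl ⟨hp, multiplePoints_subset (ψ i).injOn_fst_graph h1⟩
      · have h2 : p.2 ∈ multiplePoints (Prod.swap ⁻¹' C) := by
          by_contra h2
          exact hp' ⟨hpC, h1, h2⟩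
        refine Or.inr ⟨hp, ?_⟩
        have h3 := multiplePoints_subset (ψ i).symm.injOn_fst_graph h2
        rwa [← MeasureIso.swap_preimage_graph, ← Set.preimage_sdiff] at h3
    · exact Or.inl ⟨hp, hpC⟩
  refine (measure_mono hsub).trans ((measure_union_le _ _).trans
    ((add_le_add le_rfl (measure_union_le _ _)).trans ?_))
  have h1 := h.measure_graph_inter_fst_le i hEm hE
  have h2 := h.measure_graph_inter_snd_le i hEm hE
  have h3 : m (C \ (ψ i).graph) ≤ m ((ψ i).graph \ C ∪ C \ (ψ i).graph) :=
    measure_mono Set.subset_union_right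
  have h4 : m ((ψ i).graph \ C) ≤ m ((ψ i).graph \ C ∪ C \ (ψ i).graph) :=
    measure_mono Set.subset_union_left
  calc _ ≤ m ((ψ i).graph \ C ∪ C \ (ψ i).graph) + (m ((ψ i).graph \ C ∪ C \ (ψ i).graph) +
        m ((ψ i).graph \ C ∪ C \ (ψ i).graph)) :=
        add_le_add h4 (add_le_add (h1.trans h3) (h2.trans h3))
    _ = 3 * m ((ψ i).graph \ C ∪ C \ (ψ i).graph) := by ring

/-- An invariant subset of the graphs which has at most one point in every vertical and horizontal
section is the graph of an equivariant partial isomorphism. -/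
theorem exists_isEquivariantPartialIso [Nonempty ι] {Γ : Type u} [Group Γ] [MulAction Γ X]
    [MulAction Γ Y] (h : IsGraphMeasure ψ m) (hCm : MeasurableSet C)
    (hC : C ⊆ ⋃ i, (ψ i).graph) (hinv : ∀ (g : Γ) (p : X × Y), g • p ∈ C ↔ p ∈ C)
    (hfst : Set.InjOn Prod.fst C) (hsnd : Set.InjOn Prod.fst (Prod.swap ⁻¹' C)) :
    ∃ e : PartialEquiv X Y, IsEquivariantPartialIso Γ μ ν e ∧
      ∀ p ∈ C, p.1 ∈ e.source ∧ e p.1 = p.2 := by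
  have hC' := MeasureIso.swap_preimage_subset hC
  have hCm' : MeasurableSet (Prod.swap ⁻¹' C) := measurable_swap hCm
  obtain ⟨f, hf, hfC⟩ := MeasureIso.exists_measurable_of_injOn hCm hC hfst
  obtain ⟨f', hf', hfC'⟩ := MeasureIso.exists_measurable_of_injOn hCm' hC' hsnd
  have hfC'' : ∀ p ∈ C, f' p.2 = p.1 := fun p hp => hfC' p.swap hp
  let e : PartialEquiv X Y :=
    { toFun := f
      invFun := f'
      source := Prod.fst '' C
      target := Prod.fst '' (Prod.swap ⁻¹' C)
      map_source' := by
        rintro _ ⟨p, hp, rfl⟩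
        exact ⟨p.swap, hp, (hfC p hp).symm⟩
      map_target' := by
        rintro _ ⟨p, hp, rfl⟩
        exact ⟨p.swap, hp, (hfC' p hp).symm⟩
      left_inv' := by
        rintro _ ⟨p, hp, rfl⟩
        rw [hfC p hp, hfC'' p hp]
      right_inv' := by
        rintro _ ⟨p, hp, rfl⟩
        rw [hfC' p hp]
        exact hfC p.swap hp }
  refine ⟨e, ⟨hf, hf', measurableSet_fst_image hCm hC, measurableSet_fst_image hCm' hC', ?_, ?_,
    ?_⟩, fun p hp => ⟨⟨p, hp, rfl⟩, hfC p hp⟩⟩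
  · change (μ.restrict (Prod.fst '' C)).map f = ν.restrict (Prod.fst '' (Prod.swap ⁻¹' C))
    rw [← h.map_fst_restrict hCm hC hfst, ← h.symm.map_fst_restrict hCm' hC' hsnd,
      Measure.map_map hf measurable_fst, Measure.restrict_map measurable_swap hCm',
      Measure.map_map measurable_fst measurable_swap]
    refine Measure.map_congr ?_
    filter_upwards [ae_restrict_mem hCm] with p hp
    exact hfC p hp
  · rintro g _ ⟨p, hp, rfl⟩
    exact ⟨g • p, (hinv g p).2 hp, rfl⟩
  · rintro g _ ⟨p, hp, rfl⟩
    exact (hfC (g • p) ((hinv g p).2 hp)).trans (congrArg (g • ·) (hfC p hp).symm)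

end IsGraphMeasure

end

/-- An isomorphism of `Γ`-spaces which is almost equivariant on a Kazhdan set agrees, off a set of
small measure, with an equivariant partial isomorphism. -/
theorem IsKazhdanBound.exists_isEquivariantPartialIso {Γ : Type u} [Group Γ] [Countable Γ]
    {F : Finset Γ} {K : ℝ} (hF : IsKazhdanBound.{u, max v w} Γ F K)
    {X : Type v} {Y : Type w} [MeasurableSpace X]
    [MeasurableSpace Y] [MulAction Γ X] [MeasurableConstSMul Γ X] [MulAction Γ Y]
    [MeasurableConstSMul Γ Y] [StandardBorelSpace X] [StandardBorelSpace Y] {μ : Measure X}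
    {ν : Measure Y} [IsProbabilityMeasure μ] [IsProbabilityMeasure ν] [SMulInvariantMeasure Γ X μ]
    [SMulInvariantMeasure Γ Y ν] (θ : MeasureIso μ ν) {δ : ℝ} (hδ : 0 ≤ δ)
    (hθ : ∀ g ∈ F, isoDist ν (fun y => θ (g • θ.symm y)) (fun y => g • y) ≤ δ) :
    ∃ e : PartialEquiv X Y, IsEquivariantPartialIso Γ μ ν e ∧
      1 - 12 * (K * δ) ^ 2 ≤ μ.real {x | x ∈ e.source ∧ e x = θ x} := by
  obtain ⟨m, h⟩ := exists_isGraphMeasure fun k : Γ => θ.translate k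
  obtain ⟨A, hA, hinv, hle⟩ := hF.exists_invariant_set h hδ hθ
  have hgr : (θ.translate (1 : Γ)).graph = θ.graph := θ.graph_translate_one
  have hUm : MeasurableSet (⋃ k : Γ, (θ.translate k).graph) :=
    MeasurableSet.iUnion fun k => (θ.translate k).measurableSet_graph
  set C : Set (X × Y) := A ∩ ⋃ k : Γ, (θ.translate k).graph with hCdef
  have hCm : MeasurableSet C := hA.inter hUm
  have hC : C ⊆ ⋃ k : Γ, (θ.translate k).graph := Set.inter_subset_right
  have hCinv : ∀ (g : Γ) (p : X × Y), g • p ∈ C ↔ p ∈ C :=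
    fun g p => and_congr (hinv g p) (θ.smul_mem_iUnion_graph g p)
  have hBm := MeasureIso.measurableSet_graphPart hCm hC
  obtain ⟨e, he, heC⟩ := h.exists_isEquivariantPartialIso (Γ := Γ) hBm
    ((graphPart_subset C).trans hC) (smul_mem_graphPart_iff hCinv) (injOn_fst_graphPart C)
    (by rw [swap_preimage_graphPart]; exact injOn_fst_graphPart _)
  refine ⟨e, he, ?_⟩
  have hsmall := h.measure_graph_sdiff_graphPart_le 1 hCm hC
  rw [hgr] at hsmall
  have hsym : θ.graph \ C ∪ C \ θ.graph ⊆ θ.graph \ A ∪ A \ θ.graph := by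
    refine Set.union_subset_union ?_ (Set.sdiff_subset_sdiff_left Set.inter_subset_left)
    rintro p ⟨hp, hpC⟩
    exact ⟨hp, fun hpA => hpC ⟨hpA, Set.mem_iUnion.2 ⟨1, hgr.symm ▸ hp⟩⟩⟩
  have hm1 : m (θ.graph \ graphPart C) ≤ ENNReal.ofReal (12 * (K * δ) ^ 2) := by
    refine hsmall.trans ((mul_le_mul_right ((measure_mono hsym).trans hle) 3).trans
      (le_of_eq ?_))
    rw [← ENNReal.ofReal_ofNat, ← ENNReal.ofReal_mul (by norm_num)]
    congr 1
    ring
  have hm2 : μ {x | x ∈ e.source ∧ e x = θ x}ᶜ ≤ ENNReal.ofReal (12 * (K * δ) ^ 2) := by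
    refine le_trans ?_ hm1
    have h1 := h.measure_inter_graph 1 hBm.compl
    rw [hgr, Set.inter_comm, ← Set.sdiff_eq] at h1
    rw [h1]
    refine measure_mono fun x hx hx' => hx ?_
    have h2 : θ.translate (1 : Γ) x = θ x := by simp [MeasureIso.translate_apply]
    have h3 := heC _ hx'
    exact ⟨h3.1, h3.2.trans h2⟩
  have hmeas : MeasurableSet {x | x ∈ e.source ∧ e x = θ x} :=
    he.measurableSet_source.inter (measurableSet_eq_fun he.measurable_coe θ.measurable)
  have h4 := probReal_compl_eq_one_sub (μ := μ) hmeas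
  have h5 : μ.real {x | x ∈ e.source ∧ e x = θ x}ᶜ ≤ 12 * (K * δ) ^ 2 :=
    ENNReal.toReal_le_of_le_ofReal (by positivity) hm2
  linarith

/-! ### Passing from partial isomorphisms to isomorphisms -/

theorem isoDist_nonneg {X : Type v} {Y : Type w} [MeasurableSpace X] (μ : Measure X)
    (φ ψ : X → Y) : 0 ≤ isoDist μ φ ψ :=
  Real.sqrt_nonneg _

theorem isoDist_le {X : Type v} {Y : Type w} [MeasurableSpace X] {μ : Measure X} {φ ψ : X → Y}
    {r ε : ℝ} (hε : 0 ≤ ε) (h : 1 - r ≤ μ.real {x | φ x = ψ x}) (hr : 2 * r ≤ ε ^ 2) :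
    isoDist μ φ ψ ≤ ε :=
  Real.sqrt_le_iff.2 ⟨hε, by linarith⟩

theorem isoDist_eq_zero {X : Type v} {Y : Type w} [MeasurableSpace X] {μ : Measure X}
    [IsProbabilityMeasure μ] {φ ψ : X → Y} (h : ∀ᵐ x ∂μ, φ x = ψ x) : isoDist μ φ ψ = 0 := by
  have h1 : μ.real {x | φ x = ψ x} = 1 := by
    rw [measureReal_def, measure_congr (t := Set.univ) (eventuallyEq_univ.2 h)]
    simp
  rw [isoDist, h1]
  norm_num

/-- The choice of the tolerance `δ`: it makes the domain of the partial isomorphism non-null and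
the distance at most `ε`. -/
theorem exists_kazhdan_tolerance {K ε : ℝ} (hK : 0 ≤ K) (hε : 0 < ε) :
    ∃ δ : ℝ, 0 < δ ∧ 12 * (K * δ) ^ 2 < 1 ∧ 2 * (12 * (K * δ) ^ 2) ≤ ε ^ 2 := by
  have hm : 0 < min ε 1 := lt_min hε one_pos
  refine ⟨min ε 1 / (5 * (K + 1)), by positivity, ?_⟩
  have h1 : K * (min ε 1 / (5 * (K + 1))) ≤ min ε 1 / 5 := by
    rw [← mul_div_assoc, div_le_div_iff₀ (by positivity) (by norm_num)]
    nlinarith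
  have h2 : (K * (min ε 1 / (5 * (K + 1)))) ^ 2 ≤ (min ε 1 / 5) ^ 2 :=
    pow_le_pow_left₀ (by positivity) h1 2
  have h3 : min ε 1 ^ 2 ≤ ε ^ 2 := pow_le_pow_left₀ hm.le (min_le_left _ _) 2
  have h4 : min ε 1 ^ 2 ≤ 1 := pow_le_one₀ hm.le (min_le_right _ _)
  constructor <;> nlinarith

/-- When the domain space is ergodic, a non-null equivariant partial isomorphism is defined almost
everywhere. -/
theorem IsKazhdanBound.exists_equivariant_of_ergodicSMul {Γ : Type u} [Group Γ] [Countable Γ]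
    {F : Finset Γ} {K : ℝ} (hF : IsKazhdanBound.{u, max v w} Γ F K)
    {X : Type v} {Y : Type w} [MeasurableSpace X]
    [MeasurableSpace Y] [MulAction Γ X] [MeasurableConstSMul Γ X] [MulAction Γ Y]
    [MeasurableConstSMul Γ Y] [StandardBorelSpace X] [StandardBorelSpace Y] {μ : Measure X}
    {ν : Measure Y} [IsProbabilityMeasure μ] [IsProbabilityMeasure ν] [ErgodicSMul Γ X μ]
    [SMulInvariantMeasure Γ Y ν] (θ : MeasureIso μ ν) {δ ε : ℝ} (hδ : 0 ≤ δ)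
    (hθ : ∀ g ∈ F, isoDist ν (fun y => θ (g • θ.symm y)) (fun y => g • y) ≤ δ)
    (h12 : 12 * (K * δ) ^ 2 < 1) (h24 : 2 * (12 * (K * δ) ^ 2) ≤ ε ^ 2) (hε : 0 ≤ ε) :
    ∃ θ' : MeasureIso μ ν, (∀ g : Γ, ∀ᵐ x ∂μ, θ' (g • x) = g • θ' x) ∧ isoDist μ θ' θ ≤ ε := by
  obtain ⟨e, he, hle⟩ := hF.exists_isEquivariantPartialIso θ hδ hθ
  have hconst : EventuallyConst e.source (ae μ) :=
    aeconst_of_forall_preimage_smul_ae_eq Γ he.measurableSet_source.nullMeasurableSet fun g =>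
      ae_of_all μ fun x => propext (he.smul_mem_iff g x)
  have hfull : ∀ᵐ x ∂μ, x ∈ e.source := by
    rcases eventuallyConst_set'.1 hconst with h | h
    · exfalso
      have h1 : μ.real {x | x ∈ e.source ∧ e x = θ x} = 0 := by
        rw [measureReal_def, measure_mono_null (fun x hx => hx.1) (ae_eq_empty.1 h)]
        rfl
      linarith
    · exact eventuallyEq_univ.1 h
  obtain ⟨θ', hθ', heq⟩ := IsEquivariantPartialIso.exists_measureIso (Γ := Γ) (μ := μ) (ν := ν)
    (e := fun _ : Unit => e) (fun _ => he) (fun i j hij => (hij rfl).elim)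
    (fun i j hij => (hij rfl).elim) (by simpa using hfull)
  refine ⟨θ', heq, isoDist_le hε (hle.trans ?_) h24⟩
  exact measureReal_mono fun x hx => (hθ' () hx.1).trans hx.2

theorem Conjugate.appConjugate {Γ Λ : Type*} [Group Γ] [Group Λ] {X : Type v} {Y : Type w}
    [MulAction Γ X] [MulAction Λ Y] [MeasurableSpace X] [MeasurableSpace Y]
    {μ : Measure X} {ν : Measure Y} [IsProbabilityMeasure ν] (h : Conjugate Γ Λ μ ν) :
    AppConjugate Γ Λ μ ν := by
  obtain ⟨δ, θ, hθ⟩ := h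
  refine ⟨δ, fun _ => θ, fun g => ?_⟩
  have h0 : isoDist ν (fun y => θ (g • θ.symm y)) (fun y => δ g • y) = 0 := by
    refine isoDist_eq_zero ?_
    filter_upwards [θ.symm.measurePreserving_toFun.quasiMeasurePreserving.ae (hθ g),
      θ.right_inv] with y h1 h2
    exact h1.trans (congrArg (δ g • ·) h2)
  exact tendsto_const_nhds.congr fun _ => h0.symm

/-- A single member of an approximate conjugacy, if close enough to being equivariant, is already
close to a conjugacy. -/
theorem HasPropertyT.conjugate_of_appConjugate {Γ : Type u} [Group Γ] [Countable Γ]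
    (hT : HasPropertyT Γ) {Λ : Type*} [Group Λ] {X : Type v} {Y : Type w} [MeasurableSpace X]
    [MeasurableSpace Y] [MulAction Γ X] [MeasurableConstSMul Γ X] [MulAction Λ Y]
    [MeasurableConstSMul Λ Y] [StandardBorelSpace X] [StandardBorelSpace Y] {μ : Measure X}
    {ν : Measure Y} [IsProbabilityMeasure μ] [IsProbabilityMeasure ν] [ErgodicSMul Γ X μ]
    [SMulInvariantMeasure Λ Y ν] (h : AppConjugate Γ Λ μ ν) : Conjugate Γ Λ μ ν := by
  obtain ⟨α, θ, hθ⟩ := h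
  obtain ⟨Q, K, hK, hQ⟩ := hT.exists_isKazhdanBound.{u, max v w}
  obtain ⟨δ, hδ, h12, h24⟩ := exists_kazhdan_tolerance hK one_pos
  -- `Γ` acts on `Y` through `α`, which turns the twisted equivariance into the plain one.
  let _ : MulAction Γ Y := MulAction.compHom Y (α : Γ →* Λ)
  have : MeasurableConstSMul Γ Y := ⟨fun g => measurable_const_smul (α g)⟩
  have : SMulInvariantMeasure Γ Y ν :=
    ⟨fun g _ hs => SMulInvariantMeasure.measure_preimage_smul (α g) hs⟩
  have hev : ∀ᶠ n in atTop, ∀ g ∈ Q,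
      isoDist ν (fun y => θ n (g • (θ n).symm y)) (fun y => α g • y) ≤ δ :=
    (Finset.eventually_all Q).2 fun g _ => (hθ g).eventually (eventually_le_nhds hδ)
  obtain ⟨n, hn⟩ := hev.exists
  obtain ⟨θ', hθ', -⟩ :=
    hQ.exists_equivariant_of_ergodicSMul (θ n) hδ.le hn h12 h24 zero_le_one
  exact ⟨α, θ', hθ'⟩

/-- The identity automorphism. -/
def MeasureIso.refl {X : Type v} [MeasurableSpace X] (μ : Measure X) : MeasureIso μ μ where
  toFun := id
  invFun := id
  measurePreserving_toFun := MeasurePreserving.id μ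
  measurePreserving_invFun := MeasurePreserving.id μ
  left_inv := ae_of_all μ fun _ => rfl
  right_inv := ae_of_all μ fun _ => rfl

/-- The distances from `θ σ_g θ⁻¹` to `σ_g` and from `θ σ_g` to `σ_g θ` agree. -/
theorem MeasureIso.isoDist_conj {Γ : Type u} [Group Γ] {X : Type v} [MeasurableSpace X]
    [StandardBorelSpace X] [MulAction Γ X] [MeasurableConstSMul Γ X] {μ : Measure X}
    [SMulInvariantMeasure Γ X μ] (θ : MeasureIso μ μ) (g : Γ) :
    isoDist μ (fun y => θ (g • θ.symm y)) (fun y => g • y) =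
      isoDist μ (fun x => θ (g • x)) (fun x => g • θ x) := by
  have hm : MeasurableSet {y | θ (g • θ.symm y) = g • y} :=
    measurableSet_eq_fun
      (θ.measurable.comp ((measurable_const_smul g).comp θ.symm.measurable))
      (measurable_const_smul g)
  rw [isoDist, isoDist, measureReal_def,
    ← θ.measurePreserving_toFun.measure_preimage hm.nullMeasurableSet, measureReal_def]
  congr 4
  refine measure_congr ?_
  filter_upwards [θ.left_inv] with x hx
  have hx' : θ.symm (θ x) = x := hx
  refine propext ?_
  change θ (g • θ.symm (θ x)) = g • θ x ↔ θ (g • x) = g • θ x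
  rw [hx']

/-- Without ergodicity the partial isomorphisms are extended inside `X`; the commuting
automorphisms are then chosen as near to `θ n` as possible up to `1 / (n + 1)`. -/
theorem HasPropertyT.exists_commuting_of_asymptotically_commuting {Γ : Type u} [Group Γ]
    [Countable Γ] (hT : HasPropertyT Γ) {X : Type v} [MeasurableSpace X] [StandardBorelSpace X]
    {μ : Measure X} [IsProbabilityMeasure μ] [MulAction Γ X] [MeasurableConstSMul Γ X]
    [SMulInvariantMeasure Γ X μ] (θ : ℕ → MeasureIso μ μ)
    (hθ : ∀ g : Γ, Tendsto
      (fun n => isoDist μ (fun x => θ n (g • x)) (fun x => g • θ n x)) atTop (𝓝 0)) :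
    ∃ θ' : ℕ → MeasureIso μ μ,
      (∀ (n : ℕ) (g : Γ), ∀ᵐ x ∂μ, θ' n (g • x) = g • θ' n x) ∧
      Tendsto (fun n => isoDist μ (θ' n) (θ n)) atTop (𝓝 0) := by
  obtain ⟨Q, K, hK, hQ⟩ := hT.exists_isKazhdanBound.{u, v}
  have hnear : ∀ ε : ℝ, 0 < ε → ∀ᶠ n in atTop, ∃ φ : MeasureIso μ μ,
      (∀ g : Γ, ∀ᵐ x ∂μ, φ (g • x) = g • φ x) ∧ isoDist μ φ (θ n) ≤ ε := by
    intro ε hε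
    obtain ⟨δ, hδ, -, h24⟩ := exists_kazhdan_tolerance hK hε
    have hev : ∀ᶠ n in atTop, ∀ g ∈ Q,
        isoDist μ (fun x => θ n (g • x)) (fun x => g • θ n x) ≤ δ :=
      (Finset.eventually_all Q).2 fun g _ => (hθ g).eventually (eventually_le_nhds hδ)
    filter_upwards [hev] with n hn
    obtain ⟨e, he, hle⟩ := hQ.exists_isEquivariantPartialIso (θ n) hδ.le
      fun g hg => ((θ n).isoDist_conj g).trans_le (hn g hg)
    obtain ⟨φ, hφ, hφg⟩ := he.exists_extension
    exact ⟨φ, hφg, isoDist_le hε.le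
      (hle.trans (measureReal_mono fun x hx => (hφ hx.1).trans hx.2)) h24⟩
  let S : ℕ → Set ℝ := fun n => {r | ∃ φ : MeasureIso μ μ,
    (∀ g : Γ, ∀ᵐ x ∂μ, φ (g • x) = g • φ x) ∧ isoDist μ φ (θ n) = r}
  have hne : ∀ n, (S n).Nonempty := fun n =>
    ⟨_, MeasureIso.refl μ, fun g => ae_of_all μ fun _ => rfl, rfl⟩
  have hbdd : ∀ n, BddBelow (S n) := fun n => ⟨0, by
    rintro _ ⟨φ, -, rfl⟩
    exact isoDist_nonneg _ _ _⟩
  have hchoose : ∀ n : ℕ, ∃ φ : MeasureIso μ μ,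
      (∀ g : Γ, ∀ᵐ x ∂μ, φ (g • x) = g • φ x) ∧
      isoDist μ φ (θ n) < sInf (S n) + 1 / ((n : ℝ) + 1) := by
    intro n
    obtain ⟨_, ⟨φ, hφ, rfl⟩, hlt⟩ := exists_lt_of_csInf_lt (hne n)
      (lt_add_of_pos_right (sInf (S n)) (Nat.one_div_pos_of_nat (α := ℝ) (n := n)))
    exact ⟨φ, hφ, hlt⟩
  choose θ' hθ' hlt using hchoose
  refine ⟨θ', hθ', ?_⟩
  rw [Metric.tendsto_atTop']
  intro ε hε
  have h1 : ∀ᶠ n : ℕ in atTop, 1 / ((n : ℝ) + 1) < ε / 2 :=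
    tendsto_one_div_add_atTop_nhds_zero_nat.eventually (gt_mem_nhds (half_pos hε))
  obtain ⟨N, hN⟩ := eventually_atTop.1 (h1.and (hnear (ε / 2) (half_pos hε)))
  refine ⟨N, fun n hn => ?_⟩
  obtain ⟨h2, φ, hφ, h3⟩ := hN n hn.le
  have h4 : sInf (S n) ≤ ε / 2 := (csInf_le (hbdd n) ⟨φ, hφ, rfl⟩).trans h3
  rw [Real.dist_eq, sub_zero, abs_of_nonneg (isoDist_nonneg _ _ _)]
  linarith [hlt n]

/-! ### Rigidity of almost conjugacies -/

theorem corollary3p11 (Γ : Type u) [Group Γ] [Countable Γ] (hT : HasPropertyT Γ) :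
    -- almost intertwining isomorphisms are close to intertwining ones
    (∀ F : Finset Γ, Subgroup.closure (F : Set Γ) = ⊤ →
      ∀ ε : ℝ, 0 < ε → ∃ δ : ℝ, 0 < δ ∧
        ∀ (X : Type v) (Y : Type w) [MeasurableSpace X] [StandardBorelSpace X]
          [MeasurableSpace Y] [StandardBorelSpace Y]
          (μ : Measure X) [IsProbabilityMeasure μ] (ν : Measure Y) [IsProbabilityMeasure ν]
          [MulAction Γ X] [MeasurableConstSMul Γ X] [ErgodicSMul Γ X μ]
          [MulAction Γ Y] [MeasurableConstSMul Γ Y] [ErgodicSMul Γ Y ν],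
          EssentiallyFree Γ μ → EssentiallyFree Γ ν →
          ∀ θ : MeasureIso μ ν,
            (∀ g ∈ F, isoDist ν (fun y => θ (g • θ.symm y)) (fun y => g • y) ≤ δ) →
            ∃ θ' : MeasureIso μ ν,
              (∀ g : Γ, ∀ᵐ x ∂μ, θ' (g • x) = g • θ' x) ∧ isoDist μ θ' θ ≤ ε) ∧
    -- approximate conjugacy is the same as conjugacy
    (∀ (X : Type v) (Y : Type w) [MeasurableSpace X] [StandardBorelSpace X]
        [MeasurableSpace Y] [StandardBorelSpace Y]
        (μ : Measure X) [IsProbabilityMeasure μ] (ν : Measure Y) [IsProbabilityMeasure ν]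
        [MulAction Γ X] [MeasurableConstSMul Γ X] [ErgodicSMul Γ X μ]
        [MulAction Γ Y] [MeasurableConstSMul Γ Y] [ErgodicSMul Γ Y ν],
        EssentiallyFree Γ μ → EssentiallyFree Γ ν →
        (AppConjugate Γ Γ μ ν ↔ Conjugate Γ Γ μ ν)) ∧
    -- asymptotically commuting automorphisms are close to commuting ones
    (∀ (X : Type v) [MeasurableSpace X] [StandardBorelSpace X]
        (μ : Measure X) [IsProbabilityMeasure μ]
        [MulAction Γ X] [MeasurableConstSMul Γ X] [SMulInvariantMeasure Γ X μ]
        (θ : ℕ → MeasureIso μ μ),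
        (∀ g : Γ, Tendsto
          (fun n => isoDist μ (fun x => θ n (g • x)) (fun x => g • θ n x)) atTop (𝓝 0)) →
        ∃ θ' : ℕ → MeasureIso μ μ,
          (∀ (n : ℕ) (g : Γ), ∀ᵐ x ∂μ, θ' n (g • x) = g • θ' n x) ∧
          Tendsto (fun n => isoDist μ (θ' n) (θ n)) atTop (𝓝 0)) := by
  refine ⟨fun F hF ε hε => ?_, ?_, ?_⟩
  · obtain ⟨Q, C, hC, hQ⟩ := hT.exists_isKazhdanBound.{u, max v w}
    obtain ⟨K, hK, hFK⟩ := hQ.of_closure_eq_top hC hF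
    obtain ⟨δ, hδ, h12, h24⟩ := exists_kazhdan_tolerance hK hε
    refine ⟨δ, hδ, ?_⟩
    intro X Y _ _ _ _ μ _ ν _ _ _ _ _ _ _ _ _ θ hθ
    exact hFK.exists_equivariant_of_ergodicSMul θ hδ.le hθ h12 h24 hε.le
  · intro X Y _ _ _ _ μ _ ν _ _ _ _ _ _ _ _ _
    exact ⟨hT.conjugate_of_appConjugate, Conjugate.appConjugate⟩
  · intro X _ _ μ _ _ _ _ θ hθ
    exact hT.exists_commuting_of_asymptotically_commuting θ hθ
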